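/- Fix $\kappa>0$ and integers $\Delta\ge 1$, $t\ge 0$, and let $p=\frac{\kappa}{\sqrt\Delta}\big(1+\frac{\kappa}{\sqrt\Delta}\big)^{-1}=\widetilde\kappa/\sqrt\Delta$, where $\widetilde\kappa=\kappa(1+\kappa/\sqrt\Delta)^{-1}$. **Model.** On a finite graph $G=(V,E)$ let $(X_i)_{i\in V}$ be i.i.d. with $\mathbb P(X_i=1)=p=1-\mathbb P(X_i=0)$, and let ${\sf C}=\{i: X_i=1\}$ be the hidden set. Given $X$, the edge labels $(W_{ij})_{(i,j)\in E}$ are independent: $W_{ij}=+1$ if $X_i=X_j=1$, and $W_{ij}$ is uniform in $\{+1,-1\}$ otherwise. In addition, the edges carry labels $(U_{ij})_{(i,j)\in E}$, i.i.d. uniform in $[0,1]$ and independent of $(X,W)$. Let ${\sf Ball}_G(i;t)$ be the subgraph induced by the vertices at distance at most $t$ from $i$. An estimator $\widehat{\sf C}=\widehat{\sf C}(W,U)\subseteq V$ (measurable) is $t$-local if, for every $i$, the membership $i\in\widehat{\sf C}$ is a function of ${\sf Ball}_G(i;t)$ with its labels $W,U$ (this function may depend on $G$ and $i$). **Graphs.**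 Let $\{G_N\}$ be a sequence of $(\Delta+1)$-regular graphs, $G_N$ having vertex set $[N]$, where $N\to\infty$ along a sequence of integers. Assume that it is locally tree-like: for every $s\ge 0$ the fraction of vertices $i$ for which ${\sf Ball}_{G_N}(i;s)$ is a tree tends to $1$. Let ${\sf C}_N$ be the hidden set of the model on $G_N$. **Belief propagation.** Set $\gamma^0_{i\to j}=\kappa$, $\gamma^0_i=\kappa$ and, for $s\ge 0$, with $\partial i$ the set of neighbors of $i$, $$\gamma^{s+1}_{i\to j}=\kappa\prod_{\ell\in\partial i\setminus j}\frac{1+(1+W_{i\ell})\gamma^s_{\ell\to i}/\sqrt\Delta}{1+\gamma^s_{\ell\to i}/\sqrt\Delta},\qquad \gamma^{s+1}_{i}=\kappa\prod_{\ell\in\partial i}\frac{1+(1+W_{i\ell})\gamma^s_{\ell\to i}/\sqrt\Delta}{1+\gamma^s_{\ell\to i}/\sqrt\Delta}.$$ The belief propagation estimate after $t$ iterations is $\widehat{\sf C}^{BP}_N=\{i\in[N]:\gamma^t_i\ge\sqrt\Delta\}$. **Tree.** Let $T(t)$ be the tree with $t$ generations, rooted at $\circ$, with degree $\Delta+1$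 at each vertex except the leaves (the vertices at distance $t$ from $\circ$; for $t=0$ the tree is the single vertex $\circ$), carrying labels $(X,W)$ distributed as in the model. For $x\in\{0,1\}$ let $\widetilde\gamma^t(x)$ be a random variable distributed as $$\sqrt\Delta\,\frac{\mathbb P(X_\circ=1\mid W_{T(t)})}{\mathbb P(X_\circ=0\mid W_{T(t)})}\qquad\text{when } W_{T(t)}\sim\mathbb P(W_{T(t)}=\cdot\mid X_\circ=x).$$ **Claim.** With $\triangle$ the symmetric difference, $$\lim_{N\to\infty}\frac1N\,\mathbb E\big[|{\sf C}_N\triangle\widehat{\sf C}^{BP}_N|\big]=\Big(1-\frac{\widetilde\kappa}{\sqrt\Delta}\Big)\mathbb P\big(\widetilde\gamma^t(0)\ge\sqrt\Delta\big)+\frac{\widetilde\kappa}{\sqrt\Delta}\,\mathbb P\big(\widetilde\gamma^t(1)<\sqrt\Delta\big).$$ Further, if $\widehat{\sf C}_N$ is, for each $N$, given by any $t$-local estimator on $G_N$, then $\liminf_{N\to\infty}\frac1N\mathbb E[|{\sf C}_N\triangle\widehat{\sf C}_N|]$ is at least the right-hand side. -/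

import Mathlib

open MeasureTheory ProbabilityTheory Filter Topology

noncomputable section

namespace HiddenSet

/-- The probability `κ̃ / √Δ = (κ / √Δ) / (1 + κ / √Δ)` that a vertex lies in the hidden set. -/
def inclusionProb (κ : ℝ) (Δ : ℕ) : ℝ :=
  κ / √(Δ : ℝ) * (1 + κ / √(Δ : ℝ))⁻¹

/-- The probability mass function of a vertex variable `X_i` (`true` means `X_i = 1`). -/
def vertexProb (κ : ℝ) (Δ : ℕ) (b : Bool) : ℝ :=
  if b then inclusionProb κ Δ else 1 - inclusionProb κ Δ

/-- The probability mass function on `{+1, -1}` of `Q₁ = δ_{+1}`. -/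
def Q₁ (s : ℤˣ) : ℝ := if s = 1 then 1 else 0

/-- The probability mass function on `{+1, -1}` of `Q₀ = (1/2) δ_{+1} + (1/2) δ_{-1}`. -/
def Q₀ (_s : ℤˣ) : ℝ := 1 / 2

section Model

variable {V : Type*} [Fintype V]

open Classical in
/-- The conditional probability `P(W = w | X = x)`: independently, the label of an edge is drawn
from `Q₁` if both endpoints are in the hidden set, and from `Q₀` otherwise. -/
def edgeProb (G : SimpleGraph V) (x : V → Bool) (w : G.edgeSet → ℤˣ) : ℝ :=
  ∏ e : G.edgeSet, if ∀ v ∈ (e : Sym2 V), x v = true then Q₁ (w e) else Q₀ (w e)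

open Classical in
/-- The joint law of `(X, W)` on the graph `G`: the vertex variables are i.i.d., and, given them,
the edge labels are independent. -/
def labelLaw (G : SimpleGraph V) (κ : ℝ) (Δ : ℕ) :
    Measure ((V → Bool) × (G.edgeSet → ℤˣ)) :=
  ∑ x : V → Bool, ∑ w : G.edgeSet → ℤˣ,
    ENNReal.ofReal ((∏ i, vertexProb κ Δ (x i)) * edgeProb G x w) • Measure.dirac (x, w)

open Classical in
/-- The joint law of `((X, W), U)`, where the randomization labels `U` of the edges are i.i.d.
uniform in `[0, 1]` and independent of `(X, W)`. -/
def fullLaw (G : SimpleGraph V) (κ : ℝ) (Δ : ℕ) :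
    Measure (((V → Bool) × (G.edgeSet → ℤˣ)) × (G.edgeSet → unitInterval)) :=
  (labelLaw G κ Δ).prod (Measure.pi fun _ => volume)

/-- The hidden set `{i : X_i = 1}`. -/
def hiddenSet (x : V → Bool) : Set V := {i | x i = true}

/-- An estimator on `G`: it maps the edge labels `W`, `U` to a set of vertices. -/
abbrev Estimator (G : SimpleGraph V) : Type _ :=
  (G.edgeSet → ℤˣ) → (G.edgeSet → unitInterval) → Set V

/-- The expected size of the symmetric difference of the hidden set and its estimate. -/
def expectedError (G : SimpleGraph V) (κ : ℝ) (Δ : ℕ) (C : Estimator G) : ℝ :=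
  ∫ ω, ((symmDiff (hiddenSet ω.1.1) (C ω.1.2 ω.2)).ncard : ℝ) ∂(fullLaw G κ Δ)

/-- The vertices at graph distance at most `t` from `i` (vertices in other components are at
distance `∞`). -/
def ball (G : SimpleGraph V) (i : V) (t : ℕ) : Set V := {j | G.edist i j ≤ t}

/-- The ball, as an induced subgraph, is a tree. -/
def BallIsTree (G : SimpleGraph V) (i : V) (t : ℕ) : Prop := (G.induce (ball G i t)).IsTree

/-- A measurable estimator is `t`-local if the membership of `i` in the estimated set is a function
of the ball of radius `t` around `i` with its edge labels. This function may depend on the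
graph and on `i`. -/
structure IsLocal (G : SimpleGraph V) (t : ℕ) (C : Estimator G) : Prop where
  measurableSet : ∀ (i : V) (w : G.edgeSet → ℤˣ), MeasurableSet {u | i ∈ C w u}
  local_mem : ∀ (i : V) (w w' : G.edgeSet → ℤˣ) (u u' : G.edgeSet → unitInterval),
    (∀ e : G.edgeSet, (∀ v ∈ (e : Sym2 V), v ∈ ball G i t) → w e = w' e ∧ u e = u' e) →
      (i ∈ C w u ↔ i ∈ C w' u')

/-- The factor that the label `s` of an edge and the message `γ` sent along it contribute to an
update. -/
def bpFactor (Δ : ℕ) (s : ℤˣ) (γ : ℝ) : ℝ :=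
  (1 + (1 + ((s : ℤ) : ℝ)) * γ / √(Δ : ℝ)) / (1 + γ / √(Δ : ℝ))

open Classical in
/-- The belief propagation message `γ^t_{i → j}` along the edge `(i, j)`. -/
def bpMessage (G : SimpleGraph V) (κ : ℝ) (Δ : ℕ) (w : G.edgeSet → ℤˣ) : ℕ → V → V → ℝ
  | 0, _, _ => κ
  | t + 1, i, j => κ * ∏ l : {l : V // G.Adj i l ∧ l ≠ j},
      bpFactor Δ (w ⟨s(i, l.1), l.2.1⟩) (bpMessage G κ Δ w t l.1 i)

open Classical in
/-- The belief propagation vertex quantity `γ^t_i`. -/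
def bpVertex (G : SimpleGraph V) (κ : ℝ) (Δ : ℕ) (w : G.edgeSet → ℤˣ) : ℕ → V → ℝ
  | 0, _ => κ
  | t + 1, i => κ * ∏ l : {l : V // G.Adj i l},
      bpFactor Δ (w ⟨s(i, l.1), l.2⟩) (bpMessage G κ Δ w t l.1 i)

/-- The set of vertices obtained by thresholding the quantities `γ^t_i` at `√Δ`. -/
def bpEstimator (G : SimpleGraph V) (κ : ℝ) (Δ t : ℕ) : Estimator G :=
  fun w _ => {i | √(Δ : ℝ) ≤ bpVertex G κ Δ w t i}

/-- The rescaled posterior odds ratio `√Δ P(X_o = 1 | W = w) / P(X_o = 0 | W = w)` of `o`. -/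
def posteriorOdds (G : SimpleGraph V) (κ : ℝ) (Δ : ℕ) (o : V) (w : G.edgeSet → ℤˣ) : ℝ :=
  √(Δ : ℝ) * ((cond (labelLaw G κ Δ) {ω | ω.2 = w}).real {ω | ω.1 o = true} /
    (cond (labelLaw G κ Δ) {ω | ω.2 = w}).real {ω | ω.1 o = false})

/-- The law of the rescaled posterior odds ratio of `o` when `W` is drawn conditionally on
`X_o = b`. -/
def posteriorOddsLaw (G : SimpleGraph V) (κ : ℝ) (Δ : ℕ) (o : V) (b : Bool) : Measure ℝ :=
  (cond (labelLaw G κ Δ) {ω | ω.1 o = b}).map fun ω => posteriorOdds G κ Δ o ω.2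

end Model

/-- A sequence of finite graphs is locally tree-like if, for every `t`, the fraction of vertices
whose ball of radius `t` is a tree tends to one. -/
def LocallyTreeLike {n : ℕ → ℕ} (G : ∀ k, SimpleGraph (Fin (n k))) : Prop :=
  ∀ t : ℕ, Tendsto (fun k => ({i | BallIsTree (G k) i t}.ncard : ℝ) / (n k : ℝ)) atTop (𝓝 1)

/-- Addresses of the vertices of the infinite `(Δ+1)`-regular rooted tree, the last step of the
path from the root coming first: the root has `Δ + 1` children and every other vertex has `Δ`. -/
def IsAddress (Δ : ℕ) : List (Fin (Δ + 1)) → Prop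
  | [] => True
  | [_] => True
  | a :: b :: l => (a : ℕ) < Δ ∧ IsAddress Δ (b :: l)

/-- The vertices of the regular tree with `t` generations. -/
def TreeVertex (Δ t : ℕ) : Type := {l : List (Fin (Δ + 1)) // IsAddress Δ l ∧ l.length ≤ t}

instance (Δ t : ℕ) : Finite (TreeVertex Δ t) :=
  Set.Finite.to_subtype ((List.finite_length_le (Fin (Δ + 1)) t).subset fun _ h => h.2)

instance (Δ t : ℕ) : Fintype (TreeVertex Δ t) := Fintype.ofFinite _

/-- The root. -/
def treeRoot (Δ t : ℕ) : TreeVertex Δ t := ⟨[], by simp [IsAddress], by simp⟩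

/-- The rooted tree with `t` generations, of degree `Δ + 1` at each vertex except the leaves: two
vertices are adjacent if one is a child of the other. -/
def regularTree (Δ t : ℕ) : SimpleGraph (TreeVertex Δ t) where
  Adj u v := (∃ a, u.1 = a :: v.1) ∨ (∃ a, v.1 = a :: u.1)
  symm := ⟨fun _ _ h => h.symm⟩
  loopless := ⟨fun u h => by simp at h⟩

/-- The law of the random variable `γ̃^t(b)`. -/
def treeOddsLaw (κ : ℝ) (Δ t : ℕ) (b : Bool) : Measure ℝ :=
  posteriorOddsLaw (regularTree Δ t) κ Δ (treeRoot Δ t) b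

/-- The misclassification probability of the root of the labeled regular tree:
`(1 - κ̃/√Δ) P(γ̃^t(0) ≥ √Δ) + (κ̃/√Δ) P(γ̃^t(1) < √Δ)`. -/
def treeError (κ : ℝ) (Δ t : ℕ) : ℝ :=
  (1 - inclusionProb κ Δ) * (treeOddsLaw κ Δ t false).real (Set.Ici √(Δ : ℝ)) +
    inclusionProb κ Δ * (treeOddsLaw κ Δ t true).real (Set.Iio √(Δ : ℝ))

end HiddenSet

end

/-! By linearity the expected error is a sum over vertices of misclassification probabilities
(`expectedError_eq_sum_vertexError`). In a (Δ+1)-regular graph a ball that is a tree is a copy of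
the regular tree (`exists_regularTree_embedding`), and the labels on an induced subgraph follow the
model on that subgraph (`sum_weight_comp_embedding`). At such a vertex, with `U` frozen, a local
rule is thus a test of the root variable from the labels `W` of the tree. Each `w` costs it one of
P(X = 0, W = w), P(X = 1, W = w), hence at least their minimum. The sum of these minima is
`bayesError`, and `bayesError_eq` identifies it with the right-hand side.

Belief propagation attains this bound: summing out the tree generation by generation from the leaves
(`sum_eq_sum_likelihood`) gives a recursion for likelihood ratios which is exactly the message
update (`bpMessage_eq`, `bpVertex_eq`), and the threshold √Δ selects the larger posterior. The
remaining vertices form a vanishing fraction and cost between 0 and 1 each, so a squeeze finishes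
the proof. -/

noncomputable section

namespace HiddenSet

/-! ### Marginalization of product weights -/

/-- Each fibre of `w ↦ w ∘ φ` pins the coordinates in the range of `φ`; the free coordinates sum to
one. -/
theorem sum_prod_comp_embedding {A B S : Type*} [Fintype A] [Fintype B] [Fintype S]
    [DecidableEq A] [DecidableEq B]
    (φ : A ↪ B) (q : B → S → ℝ) (hq : ∀ b, ∑ s, q b s = 1) (F : (A → S) → ℝ) :
    ∑ w : B → S, (∏ b, q b (w b)) * F (w ∘ φ) = ∑ v : A → S, (∏ a, q (φ a) (v a)) * F v := by
  classical
  have fiber : ∀ v : A → S,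
      ∑ w : B → S, (if w ∘ φ = v then ∏ b, q b (w b) else 0) = ∏ a, q (φ a) (v a) := by
    intro v
    -- The fibre condition is distributed over the coordinates, so that the sum of products becomes
    -- a product of sums.
    have h1 : ∀ w : B → S, (if w ∘ φ = v then ∏ b, q b (w b) else 0) =
        ∏ b, (if ∀ a, φ a = b → w b = v a then q b (w b) else 0) := by
      intro w
      split_ifs with h
      · refine Finset.prod_congr rfl fun b _ => ?_
        rw [if_pos]
        rintro a rfl
        exact congrFun h a
      · obtain ⟨a, ha⟩ : ∃ a, w (φ a) ≠ v a := by
          by_contra! hc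
          exact h (funext hc)
        refine (Finset.prod_eq_zero (Finset.mem_univ (φ a)) ?_).symm
        rw [if_neg]
        exact fun hc => ha (hc a rfl)
    rw [Finset.sum_congr rfl fun w _ => h1 w,
      ← Fintype.prod_sum fun b s => if ∀ a, φ a = b → s = v a then q b s else 0]
    rw [← Finset.prod_subset (Finset.subset_univ (Finset.univ.map φ)), Finset.prod_map]
    · refine Finset.prod_congr rfl fun a _ => ?_
      rw [Finset.sum_eq_single (v a)]
      · rw [if_pos]
        intro a' ha'
        rw [φ.injective ha']
      · intro s _ hs
        rw [if_neg]
        exact fun hc => hs (hc a rfl)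
      · simp
    · intro b _ hb
      rw [← hq b]
      refine Finset.sum_congr rfl fun s _ => ?_
      rw [if_pos]
      rintro a rfl
      exact absurd (Finset.mem_map_of_mem φ (Finset.mem_univ a)) hb
  have h2 : ∀ w : B → S, (∏ b, q b (w b)) * F (w ∘ φ) =
      ∑ v : A → S, (if w ∘ φ = v then ∏ b, q b (w b) else 0) * F v := by
    intro w
    rw [Finset.sum_eq_single (w ∘ φ)]
    · simp
    · intro v _ hv
      rw [if_neg hv.symm, zero_mul]
    · simp
  rw [Finset.sum_congr rfl fun w _ => h2 w, Finset.sum_comm]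
  refine Finset.sum_congr rfl fun v _ => ?_
  rw [← Finset.sum_mul, fiber]

/-! ### Prior probabilities and edge kernels. -/

section Parameters

variable {κ : ℝ} {Δ : ℕ}

theorem inclusionProb_pos (hκ : 0 < κ) (hΔ : 1 ≤ Δ) : 0 < inclusionProb κ Δ := by
  have : 0 < √(Δ : ℝ) := Real.sqrt_pos.2 (by exact_mod_cast hΔ)
  unfold inclusionProb
  positivity

theorem one_sub_inclusionProb (hκ : 0 < κ) (hΔ : 1 ≤ Δ) :
    1 - inclusionProb κ Δ = (1 + κ / √(Δ : ℝ))⁻¹ := by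
  have : 0 < √(Δ : ℝ) := Real.sqrt_pos.2 (by exact_mod_cast hΔ)
  unfold inclusionProb
  field_simp
  ring

theorem vertexProb_pos (hκ : 0 < κ) (hΔ : 1 ≤ Δ) (b : Bool) : 0 < vertexProb κ Δ b := by
  have : 0 < √(Δ : ℝ) := Real.sqrt_pos.2 (by exact_mod_cast hΔ)
  cases b
  · simp only [vertexProb, Bool.false_eq_true, if_false, one_sub_inclusionProb hκ hΔ]
    positivity
  · simpa [vertexProb] using inclusionProb_pos hκ hΔ

/-- The prior odds are κ/√Δ; this ties the initial message κ to the threshold √Δ. -/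
theorem vertexProb_true (hκ : 0 < κ) (hΔ : 1 ≤ Δ) :
    vertexProb κ Δ true = κ / √(Δ : ℝ) * vertexProb κ Δ false := by
  simp [vertexProb, one_sub_inclusionProb hκ hΔ]
  rfl

theorem sum_vertexProb (κ : ℝ) (Δ : ℕ) : ∑ b, vertexProb κ Δ b = 1 := by
  simp [vertexProb]

end Parameters

theorem Q₀_nonneg (s : ℤˣ) : 0 ≤ Q₀ s := by unfold Q₀; norm_num

theorem Q₁_nonneg (s : ℤˣ) : 0 ≤ Q₁ s := by unfold Q₁; split_ifs <;> norm_num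

theorem sum_Q₀ : ∑ s, Q₀ s = 1 := by
  rw [Fintype.sum_eq_add (1 : ℤˣ) (-1) (by decide)]
  · norm_num [Q₀]
  · intro s hs
    rcases Int.units_eq_one_or s with h | h <;> simp_all

theorem sum_Q₁ : ∑ s, Q₁ s = 1 := by simp [Q₁]

open Classical in
/-- The conditional probability of the label `s` on the edge `e`, given the vertex variables. -/
def edgeWeight {V : Type*} (x : V → Bool) (e : Sym2 V) (s : ℤˣ) : ℝ :=
  if ∀ v ∈ e, x v = true then Q₁ s else Q₀ s

theorem edgeWeight_nonneg {V : Type*} (x : V → Bool) (e : Sym2 V) (s : ℤˣ) :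
    0 ≤ edgeWeight x e s := by
  unfold edgeWeight
  split_ifs
  exacts [Q₁_nonneg s, Q₀_nonneg s]

theorem sum_edgeWeight {V : Type*} (x : V → Bool) (e : Sym2 V) : ∑ s, edgeWeight x e s = 1 := by
  unfold edgeWeight
  split_ifs
  exacts [sum_Q₁, sum_Q₀]

theorem edgeWeight_map {V V' : Type*} (f : V' → V) (x : V → Bool) (e : Sym2 V') (s : ℤˣ) :
    edgeWeight x (e.map f) s = edgeWeight (x ∘ f) e s := by
  unfold edgeWeight
  congr 1
  simp [Sym2.mem_map]

/-! ### The joint mass function and its restriction to induced subgraphs. -/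

section Weight

variable {V : Type*} [Fintype V]

/-- The joint probability mass function of `(X, W)`. -/
def weight (G : SimpleGraph V) (κ : ℝ) (Δ : ℕ) (x : V → Bool) (w : G.edgeSet → ℤˣ) : ℝ :=
  (∏ i, vertexProb κ Δ (x i)) * edgeProb G x w

open Classical in
theorem edgeProb_eq (G : SimpleGraph V) (x : V → Bool) (w : G.edgeSet → ℤˣ) :
    edgeProb G x w = ∏ e : G.edgeSet, edgeWeight x (e : Sym2 V) (w e) := by
  unfold edgeProb edgeWeight
  refine Finset.prod_congr rfl fun e _ => ?_
  congr

theorem weight_nonneg {κ : ℝ} {Δ : ℕ} (hκ : 0 < κ) (hΔ : 1 ≤ Δ) (G : SimpleGraph V)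
    (x : V → Bool) (w : G.edgeSet → ℤˣ) : 0 ≤ weight G κ Δ x w :=
  mul_nonneg (Finset.prod_nonneg fun _ _ => (vertexProb_pos hκ hΔ _).le)
    (by rw [edgeProb_eq]; exact Finset.prod_nonneg fun _ _ => edgeWeight_nonneg _ _ _)

open Classical in
/-- The law of the labels of an induced subgraph is that of the model on that subgraph. -/
theorem sum_weight_comp_embedding {V' : Type*} [Fintype V'] {H : SimpleGraph V'}
    {G : SimpleGraph V} (φ : H ↪g G) (κ : ℝ) (Δ : ℕ)
    (F : (V' → Bool) → (H.edgeSet → ℤˣ) → ℝ) :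
    ∑ x, ∑ w, weight G κ Δ x w * F (x ∘ φ) (w ∘ φ.mapEdgeSet) =
      ∑ x, ∑ w, weight H κ Δ x w * F x w := by
  -- Edge labels are marginalized first, with `x` fixed, because their weights depend on `x`; the
  -- vertices follow.
  have h1 : ∀ x : V → Bool, ∑ w, weight G κ Δ x w * F (x ∘ φ) (w ∘ φ.mapEdgeSet) =
      (∏ i, vertexProb κ Δ (x i)) * ∑ w, edgeProb H (x ∘ φ) w * F (x ∘ φ) w := by
    intro x
    simp only [weight, mul_assoc, ← Finset.mul_sum]
    congr 1
    simp only [edgeProb_eq]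
    refine (sum_prod_comp_embedding φ.mapEdgeSet (fun e : G.edgeSet => edgeWeight x (e : Sym2 V))
      (fun e => sum_edgeWeight x _) (F (x ∘ φ))).trans ?_
    refine Finset.sum_congr rfl fun w _ => ?_
    congr 1
    refine Finset.prod_congr rfl fun e _ => ?_
    exact edgeWeight_map φ x e (w e)
  rw [Finset.sum_congr rfl fun x _ => h1 x]
  refine (sum_prod_comp_embedding φ.toEmbedding (fun _ => vertexProb κ Δ)
    (fun _ => sum_vertexProb κ Δ) (fun x => ∑ w, edgeProb H x w * F x w)).trans ?_
  simp only [weight, mul_assoc, Finset.mul_sum]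

open Classical in
theorem sum_edgeProb (G : SimpleGraph V) (x : V → Bool) : ∑ w, edgeProb G x w = 1 := by
  simp only [edgeProb_eq]
  rw [← Fintype.prod_sum fun (e : G.edgeSet) s => edgeWeight x (e : Sym2 V) s]
  exact Finset.prod_eq_one fun e _ => sum_edgeWeight x _

open Classical in
theorem sum_weight (G : SimpleGraph V) (κ : ℝ) (Δ : ℕ) : ∑ x, ∑ w, weight G κ Δ x w = 1 := by
  simp only [weight, ← Finset.mul_sum, sum_edgeProb, mul_one]
  rw [← Fintype.prod_sum fun (_ : V) b => vertexProb κ Δ b]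
  exact Finset.prod_eq_one fun e _ => sum_vertexProb κ Δ

end Weight

/-! ### Expectations under the laws of the model -/

instance : MeasurableSingletonClass ℤˣ where
  measurableSet_singleton s := by
    refine ⟨{(s : ℤ)}, measurableSet_singleton _, ?_⟩
    ext r
    simp [Units.ext_iff]

section Law

variable {V : Type*} [Fintype V] {κ : ℝ} {Δ : ℕ}

instance (G : SimpleGraph V) (κ : ℝ) (Δ : ℕ) : IsFiniteMeasure (labelLaw G κ Δ) := by
  classical
  constructor
  simp only [labelLaw, Measure.finsetSum_apply, Measure.smul_apply, measure_univ, smul_eq_mul,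
    mul_one]
  exact ENNReal.sum_lt_top.2 fun _ _ => ENNReal.sum_lt_top.2 fun _ _ => ENNReal.ofReal_lt_top

open Classical in
theorem integral_labelLaw (hκ : 0 < κ) (hΔ : 1 ≤ Δ) (G : SimpleGraph V)
    (f : (V → Bool) × (G.edgeSet → ℤˣ) → ℝ) :
    ∫ ω, f ω ∂(labelLaw G κ Δ) = ∑ x, ∑ w, weight G κ Δ x w * f (x, w) := by
  unfold labelLaw
  have hfin : ∀ (x : V → Bool) (w : G.edgeSet → ℤˣ), IsFiniteMeasure
      (ENNReal.ofReal ((∏ i, vertexProb κ Δ (x i)) * edgeProb G x w) • Measure.dirac (x, w)) :=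
    fun x w => Measure.smul_finite _ ENNReal.ofReal_ne_top
  rw [integral_finsetSum_measure fun _ _ => Integrable.of_finite]
  refine Finset.sum_congr rfl fun x _ => ?_
  rw [integral_finsetSum_measure fun _ _ => Integrable.of_finite]
  refine Finset.sum_congr rfl fun w _ => ?_
  rw [integral_smul_measure, integral_dirac, smul_eq_mul]
  congr 1
  exact ENNReal.toReal_ofReal (weight_nonneg hκ hΔ G x w)

open Classical in
theorem real_labelLaw (hκ : 0 < κ) (hΔ : 1 ≤ Δ) (G : SimpleGraph V)
    (S : Set ((V → Bool) × (G.edgeSet → ℤˣ))) :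
    (labelLaw G κ Δ).real S =
      ∑ x, ∑ w, weight G κ Δ x w * S.indicator 1 (x, w) := by
  rw [← integral_indicator_one (Set.toFinite S).measurableSet, integral_labelLaw hκ hΔ]

open Classical in
/-- The probability that the estimator misclassifies the vertex `i`, given `U = u`. -/
def condVertexError (G : SimpleGraph V) (κ : ℝ) (Δ : ℕ) (C : Estimator G) (i : V)
    (u : G.edgeSet → unitInterval) : ℝ :=
  ∑ x, ∑ w, weight G κ Δ x w * (if x i = true ↔ i ∈ C w u then 0 else 1)

open Classical in
/-- The probability that the estimator misclassifies the vertex `i`. -/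
def vertexError (G : SimpleGraph V) (κ : ℝ) (Δ : ℕ) (C : Estimator G) (i : V) : ℝ :=
  ∫ u, condVertexError G κ Δ C i u ∂(Measure.pi fun _ : G.edgeSet => (volume : Measure unitInterval))

theorem condVertexError_nonneg (hκ : 0 < κ) (hΔ : 1 ≤ Δ) (G : SimpleGraph V) (C : Estimator G)
    (i : V) (u : G.edgeSet → unitInterval) : 0 ≤ condVertexError G κ Δ C i u := by
  classical
  refine Finset.sum_nonneg fun x _ => Finset.sum_nonneg fun w _ =>
    mul_nonneg (weight_nonneg hκ hΔ G x w) ?_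
  split_ifs <;> norm_num

theorem condVertexError_le_one (hκ : 0 < κ) (hΔ : 1 ≤ Δ) (G : SimpleGraph V) (C : Estimator G)
    (i : V) (u : G.edgeSet → unitInterval) : condVertexError G κ Δ C i u ≤ 1 := by
  classical
  refine le_trans ?_ (sum_weight G κ Δ).le
  refine Finset.sum_le_sum fun x _ => Finset.sum_le_sum fun w _ =>
    mul_le_of_le_one_right (weight_nonneg hκ hΔ G x w) ?_
  split_ifs <;> norm_num

theorem measurable_ite_mem {V : Type*} {G : SimpleGraph V} {C : Estimator G}
    (hC : ∀ (i : V) (w : G.edgeSet → ℤˣ), MeasurableSet {u | i ∈ C w u}) (i : V)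
    (x : V → Bool) (w : G.edgeSet → ℤˣ) [∀ u, Decidable (x i = true ↔ i ∈ C w u)] :
    Measurable fun u => if x i = true ↔ i ∈ C w u then (0 : ℝ) else 1 := by
  refine Measurable.ite ?_ measurable_const measurable_const
  by_cases h : x i = true
  · simpa [h] using hC i w
  · simp only [h, false_iff, Bool.false_eq_true]
    exact (hC i w).compl

theorem measurable_condVertexError {G : SimpleGraph V} {C : Estimator G}
    (hC : ∀ (i : V) (w : G.edgeSet → ℤˣ), MeasurableSet {u | i ∈ C w u}) (i : V) :
    Measurable (condVertexError G κ Δ C i) := by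
  classical
  refine Finset.measurable_sum _ fun x _ => Finset.measurable_sum _ fun w _ => ?_
  exact (measurable_ite_mem hC i x w).const_mul _

theorem integrable_condVertexError (hκ : 0 < κ) (hΔ : 1 ≤ Δ) {G : SimpleGraph V}
    {C : Estimator G} (hC : ∀ (i : V) (w : G.edgeSet → ℤˣ), MeasurableSet {u | i ∈ C w u})
    (i : V) (μ : Measure (G.edgeSet → unitInterval)) [IsFiniteMeasure μ] :
    Integrable (condVertexError G κ Δ C i) μ := by
  refine Integrable.of_bound (C := 1) (measurable_condVertexError hC i).aestronglyMeasurable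
    (Eventually.of_forall fun u => ?_)
  rw [Real.norm_of_nonneg (condVertexError_nonneg hκ hΔ G C i u)]
  exact condVertexError_le_one hκ hΔ G C i u

open Classical in
theorem ncard_symmDiff_hiddenSet (x : V → Bool) (S : Set V) :
    ((symmDiff (hiddenSet x) S).ncard : ℝ) = ∑ i, if x i = true ↔ i ∈ S then (0 : ℝ) else 1 := by
  rw [Set.ncard_eq_toFinset_card', Finset.card_eq_sum_ones, Nat.cast_sum,
    ← Finset.sum_subset (Finset.subset_univ (symmDiff (hiddenSet x) S).toFinset)]
  · refine Finset.sum_congr rfl fun i hi => ?_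
    rw [if_neg]
    · simp
    · rw [Set.mem_toFinset, Set.mem_symmDiff] at hi
      simp only [hiddenSet, Set.mem_ofPred_eq] at hi
      tauto
  · intro i _ hi
    rw [if_pos]
    rw [Set.mem_toFinset, Set.mem_symmDiff] at hi
    simp only [hiddenSet, Set.mem_ofPred_eq] at hi
    tauto

/-- Fubini with `U` outermost, so that later arguments can work at a fixed `u` with finite sums. -/
theorem expectedError_eq_sum_vertexError (hκ : 0 < κ) (hΔ : 1 ≤ Δ) {G : SimpleGraph V}
    {C : Estimator G} (hC : ∀ (i : V) (w : G.edgeSet → ℤˣ), MeasurableSet {u | i ∈ C w u}) :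
    expectedError G κ Δ C = ∑ i, vertexError G κ Δ C i := by
  classical
  have key : ∀ ω : ((V → Bool) × (G.edgeSet → ℤˣ)) × (G.edgeSet → unitInterval),
      ((symmDiff (hiddenSet ω.1.1) (C ω.1.2 ω.2)).ncard : ℝ) =
        ∑ i, if ω.1.1 i = true ↔ i ∈ C ω.1.2 ω.2 then (0 : ℝ) else 1 :=
    fun ω => ncard_symmDiff_hiddenSet _ _
  unfold expectedError fullLaw
  simp only [key]
  rw [integral_prod_symm]
  · simp only [integral_labelLaw hκ hΔ]
    have h1 : ∀ u : G.edgeSet → unitInterval,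
        (∑ x, ∑ w, weight G κ Δ x w * ∑ i, if x i = true ↔ i ∈ C w u then (0 : ℝ) else 1) =
          ∑ i, condVertexError G κ Δ C i u := by
      intro u
      simp only [condVertexError, Finset.mul_sum]
      rw [Finset.sum_comm' (t' := Finset.univ) (s' := fun _ => Finset.univ) (by simp)]
      rw [Finset.sum_comm]
      conv_lhs => enter [2, x]; rw [Finset.sum_comm]
      rw [Finset.sum_comm]
    simp only [h1]
    rw [integral_finsetSum _ fun i _ => integrable_condVertexError hκ hΔ hC i _]
    rfl
  · refine Integrable.of_bound (C := Fintype.card V) ?_ (Eventually.of_forall fun ω => ?_)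
    · refine Measurable.aestronglyMeasurable (Finset.measurable_sum _ fun i _ => ?_)
      refine measurable_from_prod_countable_right fun ω => ?_
      exact measurable_ite_mem hC i ω.1 ω.2
    · refine (norm_sum_le _ _).trans ?_
      refine (Finset.sum_le_card_nsmul _ _ 1 fun i _ => ?_).trans (by simp)
      split_ifs <;> simp

theorem vertexError_nonneg (hκ : 0 < κ) (hΔ : 1 ≤ Δ) (G : SimpleGraph V) (C : Estimator G)
    (i : V) : 0 ≤ vertexError G κ Δ C i :=
  integral_nonneg fun u => condVertexError_nonneg hκ hΔ G C i u

theorem vertexError_le_one (hκ : 0 < κ) (hΔ : 1 ≤ Δ) {G : SimpleGraph V} {C : Estimator G}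
    (hC : ∀ (i : V) (w : G.edgeSet → ℤˣ), MeasurableSet {u | i ∈ C w u}) (i : V) :
    vertexError G κ Δ C i ≤ 1 := by
  classical
  refine (integral_mono (integrable_condVertexError hκ hΔ hC i _) (integrable_const (1 : ℝ))
    fun u => condVertexError_le_one hκ hΔ G C i u).trans ?_
  simp

/-! ### The Bayes error of a vertex -/

theorem real_cond_apply {Ω : Type*} [MeasurableSpace Ω] (μ : Measure Ω) {s : Set Ω}
    (hs : MeasurableSet s) (t : Set Ω) :
    (cond μ s).real t = (μ.real s)⁻¹ * μ.real (s ∩ t) := by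
  simp [Measure.real, cond_apply hs]

open Classical in
/-- The probability that `X_o = b` and `W = w`. -/
def marginal (G : SimpleGraph V) (κ : ℝ) (Δ : ℕ) (o : V) (b : Bool) (w : G.edgeSet → ℤˣ) : ℝ :=
  ∑ x, if x o = b then weight G κ Δ x w else 0

/-- The all-false configuration has positive weight for every `w`, as no edge is then forced to be
+1. Odds ratios therefore have nonzero denominators. -/
theorem marginal_false_pos (hκ : 0 < κ) (hΔ : 1 ≤ Δ) (G : SimpleGraph V) (o : V)
    (w : G.edgeSet → ℤˣ) : 0 < marginal G κ Δ o false w := by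
  classical
  refine Finset.sum_pos' (fun x _ => ?_) ⟨fun _ => false, Finset.mem_univ _, ?_⟩
  · split_ifs
    exacts [weight_nonneg hκ hΔ G x w, le_rfl]
  · rw [if_pos rfl, weight, edgeProb_eq]
    refine mul_pos (Finset.prod_pos fun _ _ => vertexProb_pos hκ hΔ _)
      (Finset.prod_pos fun e _ => ?_)
    obtain ⟨e, he⟩ := e
    induction e with | _ a b =>
    rw [edgeWeight, if_neg fun h => by simpa using h a (Sym2.mem_mk_left a b), Q₀]
    norm_num

open Classical in
theorem real_labelLaw_vertex (hκ : 0 < κ) (hΔ : 1 ≤ Δ) (G : SimpleGraph V) (o : V) (b : Bool) :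
    (labelLaw G κ Δ).real {ω | ω.1 o = b} = vertexProb κ Δ b := by
  rw [real_labelLaw hκ hΔ]
  have h : ∀ x : V → Bool, ∑ w, weight G κ Δ x w *
      Set.indicator {ω : (V → Bool) × (G.edgeSet → ℤˣ) | ω.1 o = b} 1 (x, w) =
        (∏ i, vertexProb κ Δ (x i)) * if x o = b then 1 else 0 := by
    intro x
    have h' : ∀ w, Set.indicator {ω : (V → Bool) × (G.edgeSet → ℤˣ) | ω.1 o = b}
        (1 : (V → Bool) × (G.edgeSet → ℤˣ) → ℝ) (x, w) = if x o = b then 1 else 0 := fun w => by simp [Set.indicator_apply]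
    simp only [h', ← Finset.sum_mul, weight, ← Finset.mul_sum, sum_edgeProb, mul_one]
  rw [Finset.sum_congr rfl fun x _ => h x]
  have := sum_prod_comp_embedding (⟨fun _ : Unit => o, fun _ _ _ => rfl⟩ : Unit ↪ V)
    (fun _ => vertexProb κ Δ) (fun _ => sum_vertexProb κ Δ)
    (fun v => if v () = b then (1 : ℝ) else 0)
  refine this.trans ?_
  rw [Finset.sum_eq_single fun _ => b]
  · simp
  · intro v _ hv
    rw [if_neg, mul_zero]
    exact fun h => hv (funext fun _ => h)
  · simp

theorem real_labelLaw_inter (hκ : 0 < κ) (hΔ : 1 ≤ Δ) (G : SimpleGraph V) (o : V) (b : Bool)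
    (S : Set (G.edgeSet → ℤˣ)) [DecidablePred (· ∈ S)] [Fintype (G.edgeSet → ℤˣ)] :
    (labelLaw G κ Δ).real ({ω | ω.1 o = b} ∩ {ω | ω.2 ∈ S}) =
      ∑ w, if w ∈ S then marginal G κ Δ o b w else 0 := by
  classical
  rw [real_labelLaw hκ hΔ, Finset.sum_comm]
  refine Finset.sum_congr (by ext; simp) fun w _ => ?_
  split_ifs with h
  · refine Finset.sum_congr rfl fun x _ => ?_
    simp [h, Set.indicator_apply]
  · simp [h]

/-- The normalization P(W = w) is positive and cancels. -/
theorem posteriorOdds_eq (hκ : 0 < κ) (hΔ : 1 ≤ Δ) (G : SimpleGraph V) (o : V)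
    (w : G.edgeSet → ℤˣ) :
    posteriorOdds G κ Δ o w =
      √(Δ : ℝ) * (marginal G κ Δ o true w / marginal G κ Δ o false w) := by
  classical
  have h : ∀ b, (labelLaw G κ Δ).real ({ω | ω.2 = w} ∩ {ω | ω.1 o = b}) =
      marginal G κ Δ o b w := by
    intro b
    rw [Set.inter_comm]
    have := real_labelLaw_inter hκ hΔ G o b {w}
    simpa using this
  have hpos : 0 < (labelLaw G κ Δ).real {ω | ω.2 = w} :=
    (marginal_false_pos hκ hΔ G o w).trans_le (by
      rw [← h false]
      exact measureReal_mono Set.inter_subset_left)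
  unfold posteriorOdds
  rw [real_cond_apply _ (Set.toFinite _).measurableSet, real_cond_apply _ (Set.toFinite _).measurableSet,
    h, h, mul_div_mul_left _ _ (inv_ne_zero hpos.ne')]

theorem sqrt_le_posteriorOdds_iff (hκ : 0 < κ) (hΔ : 1 ≤ Δ) (G : SimpleGraph V) (o : V)
    (w : G.edgeSet → ℤˣ) : √(Δ : ℝ) ≤ posteriorOdds G κ Δ o w ↔
      marginal G κ Δ o false w ≤ marginal G κ Δ o true w := by
  have : 0 < √(Δ : ℝ) := Real.sqrt_pos.2 (by exact_mod_cast hΔ)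
  rw [posteriorOdds_eq hκ hΔ, le_mul_iff_one_le_right this,
    one_le_div (marginal_false_pos hκ hΔ G o w)]

theorem vertexProb_mul_real_posteriorOddsLaw (hκ : 0 < κ) (hΔ : 1 ≤ Δ) (G : SimpleGraph V)
    (o : V) (b : Bool) {S : Set ℝ} (hS : MeasurableSet S) :
    vertexProb κ Δ b * (posteriorOddsLaw G κ Δ o b).real S =
      (labelLaw G κ Δ).real ({ω | ω.1 o = b} ∩ {ω | ω.2 ∈ posteriorOdds G κ Δ o ⁻¹' S}) := by
  unfold posteriorOddsLaw
  rw [map_measureReal_apply (measurable_of_finite _) hS,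
    real_cond_apply _ (Set.toFinite _).measurableSet, real_labelLaw_vertex hκ hΔ, ← mul_assoc,
    mul_inv_cancel₀ (vertexProb_pos hκ hΔ b).ne', one_mul]
  rfl

/-- The least probability of misclassifying `o` with an estimator that sees `W`. -/
def bayesError (G : SimpleGraph V) (κ : ℝ) (Δ : ℕ) (o : V) : ℝ :=
  letI : Fintype (G.edgeSet → ℤˣ) := Fintype.ofFinite _
  ∑ w, min (marginal G κ Δ o false w) (marginal G κ Δ o true w)

/-- Each `w` lies in exactly one of the two error events, the one whose joint probability is the
smaller. -/
theorem bayesError_eq (hκ : 0 < κ) (hΔ : 1 ≤ Δ) (G : SimpleGraph V) (o : V) :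
    (1 - inclusionProb κ Δ) * (posteriorOddsLaw G κ Δ o false).real (Set.Ici √(Δ : ℝ)) +
      inclusionProb κ Δ * (posteriorOddsLaw G κ Δ o true).real (Set.Iio √(Δ : ℝ)) =
      bayesError G κ Δ o := by
  classical
  have h0 := vertexProb_mul_real_posteriorOddsLaw hκ hΔ G o false
    (measurableSet_Ici (a := √(Δ : ℝ)))
  have h1 := vertexProb_mul_real_posteriorOddsLaw hκ hΔ G o true
    (measurableSet_Iio (a := √(Δ : ℝ)))
  rw [real_labelLaw_inter hκ hΔ] at h0 h1
  simp only [vertexProb, Bool.false_eq_true, if_true, if_false] at h0 h1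
  rw [h0, h1, ← Finset.sum_add_distrib]
  unfold bayesError
  refine Finset.sum_congr (by ext; simp) fun w _ => ?_
  simp only [Set.mem_preimage, Set.mem_Ici, Set.mem_Iio, ← not_le,
    sqrt_le_posteriorOdds_iff hκ hΔ]
  by_cases h : marginal G κ Δ o false w ≤ marginal G κ Δ o true w
  · simp [h]
  · simp [h, (not_le.1 h).le]

end Law

theorem treeError_eq_bayesError {κ : ℝ} {Δ : ℕ} (hκ : 0 < κ) (hΔ : 1 ≤ Δ) (t : ℕ) :
    treeError κ Δ t = bayesError (regularTree Δ t) κ Δ (treeRoot Δ t) :=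
  bayesError_eq hκ hΔ _ _

/-! ### Comparison of estimators on a graph with Bayes tests on an induced subgraph. -/

section Restriction

variable {V V' : Type*} [Fintype V] [Fintype V'] {κ : ℝ} {Δ : ℕ}

open Classical in
/-- An estimator whose decision about `φ o` depends only on the labels of the induced subgraph `H`
errs there as an estimator on `H` does. -/
theorem condVertexError_comp_embedding {H : SimpleGraph V'} {G : SimpleGraph V} (φ : H ↪g G)
    (C : Estimator G) (o : V') (u : G.edgeSet → unitInterval) (S : Set (H.edgeSet → ℤˣ))
    (hS : ∀ w, φ o ∈ C w u ↔ w ∘ φ.mapEdgeSet ∈ S) :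
    condVertexError G κ Δ C (φ o) u =
      ∑ w, if w ∈ S then marginal H κ Δ o false w else marginal H κ Δ o true w := by
  have h := sum_weight_comp_embedding φ κ Δ fun x w => if x o = true ↔ w ∈ S then 0 else 1
  have h' : condVertexError G κ Δ C (φ o) u =
      ∑ x, ∑ w, weight H κ Δ x w * if x o = true ↔ w ∈ S then 0 else 1 := by
    rw [← h]
    unfold condVertexError
    refine Finset.sum_congr rfl fun x _ => Finset.sum_congr rfl fun w _ => ?_
    simp only [hS, Function.comp_apply]
  rw [h', Finset.sum_comm]
  refine Finset.sum_congr rfl fun w _ => ?_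
  split_ifs with hw
  all_goals
    refine Finset.sum_congr rfl fun x _ => ?_
    cases hx : x o <;> simp [hw]

theorem bayesError_le_condVertexError {H : SimpleGraph V'} {G : SimpleGraph V}
    (φ : H ↪g G) (C : Estimator G) (o : V') (u : G.edgeSet → unitInterval)
    (hC : ∀ w w' : G.edgeSet → ℤˣ, w ∘ φ.mapEdgeSet = w' ∘ φ.mapEdgeSet →
      (φ o ∈ C w u ↔ φ o ∈ C w' u)) :
    bayesError H κ Δ o ≤ condVertexError G κ Δ C (φ o) u := by
  classical
  -- The decision factors through the restriction, so its acceptance region is the image of the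
  -- original one.
  rw [condVertexError_comp_embedding φ C o u {v | ∃ w, w ∘ φ.mapEdgeSet = v ∧ φ o ∈ C w u}
    fun w => ⟨fun h => ⟨w, rfl, h⟩, fun ⟨w', h, h'⟩ => (hC w' w h).1 h'⟩]
  unfold bayesError
  refine (Finset.sum_congr (by ext; simp) fun _ _ => rfl).trans_le
    (Finset.sum_le_sum fun w _ => ?_)
  split_ifs
  exacts [min_le_left _ _, min_le_right _ _]

theorem condVertexError_eq_bayesError {H : SimpleGraph V'} {G : SimpleGraph V} (φ : H ↪g G)
    (C : Estimator G) (o : V') (u : G.edgeSet → unitInterval)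
    (hC : ∀ w, φ o ∈ C w u ↔ marginal H κ Δ o false (w ∘ φ.mapEdgeSet) ≤
      marginal H κ Δ o true (w ∘ φ.mapEdgeSet)) :
    condVertexError G κ Δ C (φ o) u = bayesError H κ Δ o := by
  classical
  rw [condVertexError_comp_embedding φ C o u
    {w | marginal H κ Δ o false w ≤ marginal H κ Δ o true w} hC]
  unfold bayesError
  refine Finset.sum_congr (by ext; simp) fun w _ => ?_
  split_ifs with h
  exacts [(min_eq_left h).symm, (min_eq_right (not_le.1 h).le).symm]

end Restriction

/-! ### Tree-like balls of regular graphs -/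

theorem IsAddress.tail {Δ : ℕ} {a : Fin (Δ + 1)} {l : List (Fin (Δ + 1))}
    (h : IsAddress Δ (a :: l)) : IsAddress Δ l := by
  cases l with
  | nil => trivial
  | cons b l => exact h.2

/-- In an acyclic graph a walk is a path as soon as it never backtracks, so only the new first step
needs checking. -/
theorem isPath_cons_of_isAcyclic {V : Type*} {T : SimpleGraph V} (hT : T.IsAcyclic) {u v r : V}
    (h : T.Adj u v) {p : T.Walk v r} (hp : p.IsPath) (hne : ¬p.Nil → u ≠ p.snd) :
    (SimpleGraph.Walk.cons h p).IsPath := by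
  rw [hT.isPath_iff_isChain] at hp ⊢
  cases p with
  | nil => simp
  | cons h' q =>
    rw [SimpleGraph.Walk.edges_cons, SimpleGraph.Walk.edges_cons, List.isChain_cons_cons]
    refine ⟨fun heq => hne (by simp) ?_, hp⟩
    rcases Sym2.eq_iff.1 heq with h1 | h1
    · exact absurd h1.1 h.ne
    · simpa using h1.1

/-- Enumerations of the neighbors of each vertex `v`, depending on a second vertex, which is
listed last if it is a neighbor of `v`. -/
structure NeighborEnum {V : Type*} (G : SimpleGraph V) (Δ : ℕ) where
  toFun : V → V → Fin (Δ + 1) → V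
  injective : ∀ v p, Function.Injective (toFun v p)
  adj : ∀ v p a, G.Adj v (toFun v p a)
  exists_eq : ∀ v p y, G.Adj v y → ∃ a, toFun v p a = y
  last : ∀ v p, G.Adj v p → toFun v p (Fin.last Δ) = p

theorem nonempty_neighborEnum {V : Type*} {G : SimpleGraph V} {Δ : ℕ}
    (hreg : ∀ v, (G.neighborSet v).ncard = Δ + 1) : Nonempty (NeighborEnum G Δ) := by
  classical
  have key : ∀ v p, ∃ σ : Fin (Δ + 1) ≃ G.neighborSet v,
      G.Adj v p → (σ (Fin.last Δ) : V) = p := by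
    intro v p
    have hc : Nat.card (G.neighborSet v) = Δ + 1 := hreg v
    have : Finite (G.neighborSet v) := Nat.finite_of_card_ne_zero (by omega)
    let σ := (Finite.equivFinOfCardEq hc).symm
    by_cases h : G.Adj v p
    -- A transposition moves `p` to the last index of an arbitrary enumeration.
    · refine ⟨(Equiv.swap (Fin.last Δ) (σ.symm ⟨p, h⟩)).trans σ, fun _ => ?_⟩
      simp
    · exact ⟨σ, fun h' => absurd h' h⟩
  choose σ hσ using key
  exact ⟨{
    toFun := fun v p a => σ v p a
    injective := fun v p => Subtype.val_injective.comp (σ v p).injective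
    adj := fun v p a => (σ v p a).2
    exists_eq := fun v p y hy => ⟨(σ v p).symm ⟨y, hy⟩, by simp⟩
    last := hσ }⟩

namespace NeighborEnum

variable {V : Type*} {G : SimpleGraph V} {Δ : ℕ} (e : NeighborEnum G Δ) (i : V)

/-- The vertex of `G` with the given address, together with its parent. -/
def locate : List (Fin (Δ + 1)) → V × V
  -- The root serves as its own parent: it is not its own neighbor, so no index is reserved and all
  -- Δ+1 lead to children.
  | [] => (i, i)
  | a :: l => (e.toFun (locate l).1 (locate l).2 a, (locate l).1)

/-- The vertex of `G` with the given address. -/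
def pos (l : List (Fin (Δ + 1))) : V := (e.locate i l).1

theorem adj_pos_cons (a : Fin (Δ + 1)) (l : List (Fin (Δ + 1))) :
    G.Adj (e.pos i l) (e.pos i (a :: l)) := e.adj _ _ _

theorem pos_cons_inj {a b : Fin (Δ + 1)} {l : List (Fin (Δ + 1))}
    (h : e.pos i (a :: l) = e.pos i (b :: l)) : a = b := e.injective _ _ h

theorem pos_last (b : Fin (Δ + 1)) (l : List (Fin (Δ + 1))) :
    e.pos i (Fin.last Δ :: b :: l) = e.pos i l :=
  e.last _ _ (e.adj_pos_cons i b l).symm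

theorem pos_cons_cons_ne {a b : Fin (Δ + 1)} {l : List (Fin (Δ + 1))} (ha : (a : ℕ) < Δ) :
    e.pos i (a :: b :: l) ≠ e.pos i l := by
  intro h
  rw [← e.pos_last i b l] at h
  have := e.pos_cons_inj i h
  simp [this] at ha

/-- Away from the root the last index leads back to the parent and the others to children; at the
root every index leads to a child. -/
theorem adj_pos_iff {l : List (Fin (Δ + 1))} (hl : IsAddress Δ l) {y : V} :
    G.Adj (e.pos i l) y ↔ (∃ a, IsAddress Δ (a :: l) ∧ y = e.pos i (a :: l)) ∨
      ∃ b l', l = b :: l' ∧ y = e.pos i l' := by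
  constructor
  · intro h
    obtain ⟨a, rfl⟩ := e.exists_eq (e.locate i l).1 (e.locate i l).2 y h
    cases l with
    | nil => exact Or.inl ⟨a, trivial, rfl⟩
    | cons b l =>
      by_cases ha : (a : ℕ) < Δ
      · exact Or.inl ⟨a, ⟨ha, hl⟩, rfl⟩
      · have : a = Fin.last Δ := by
          ext
          have := a.2
          simp only [Fin.val_last]
          omega
        subst this
        exact Or.inr ⟨b, l, rfl, e.pos_last i b l⟩
  · rintro (⟨a, -, rfl⟩ | ⟨b, l', rfl, rfl⟩)
    · exact e.adj_pos_cons i a l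
    · exact (e.adj_pos_cons i b l').symm

theorem edist_pos_le (l : List (Fin (Δ + 1))) : G.edist i (e.pos i l) ≤ l.length := by
  induction l with
  | nil => simp [pos, locate]
  | cons a l ih =>
    refine (G.edist_triangle (v := e.pos i l)).trans ?_
    rw [SimpleGraph.edist_eq_one_iff_adj.2 (e.adj_pos_cons i a l), List.length_cons,
      Nat.cast_add, Nat.cast_one]
    gcongr

/-- Read from `i`, each step of a walk lengthens or shortens the address by one; hence the positions
cover the ball. -/
theorem exists_pos_eq {j : V} (p : G.Walk j i) :
    ∃ l, IsAddress Δ l ∧ l.length ≤ p.length ∧ e.pos i l = j := by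
  induction p with
  | nil => exact ⟨[], trivial, by simp, rfl⟩
  | cons h p ih =>
    obtain ⟨l, hl, hlen, rfl⟩ := ih
    rcases (e.adj_pos_iff _ hl).1 h.symm with ⟨a, ha, rfl⟩ | ⟨b, l', rfl, rfl⟩
    · exact ⟨a :: l, ha, by simpa using hlen, rfl⟩
    · refine ⟨l', hl.tail, ?_, rfl⟩
      simp only [SimpleGraph.Walk.length_cons, List.length_cons] at hlen ⊢
      omega

/-- Siblings have distinct positions, so the trail of positions back to the root recovers each index
in turn. -/
theorem eq_of_map_tails_eq {l l' : List (Fin (Δ + 1))}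
    (h : l.tails.map (e.pos i) = l'.tails.map (e.pos i)) : l = l' := by
  induction l generalizing l' with
  | nil =>
    have := congrArg List.length h
    simp at this
    exact this.symm
  | cons a l ih =>
    cases l' with
    | nil => simpa using congrArg List.length h
    | cons b l' =>
      simp only [List.tails_cons, List.map_cons, List.cons.injEq] at h
      obtain rfl := ih h.2
      rw [e.pos_cons_inj i h.1]

/-- In a tree the position of an address determines the path to the root. -/
theorem exists_isPath {B : Set V} (hT : (G.induce B).IsAcyclic) {l : List (Fin (Δ + 1))}
    (hl : IsAddress Δ l) (hB : ∀ s ∈ l.tails, e.pos i s ∈ B) (x y : B) (hx : x = e.pos i l)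
    (hy : (y : V) = i) :
    ∃ p : (G.induce B).Walk x y, p.IsPath ∧ p.support.map Subtype.val = l.tails.map (e.pos i) := by
  induction l generalizing x with
  | nil =>
    obtain rfl : x = y := Subtype.ext (hx.trans hy.symm)
    exact ⟨.nil, by simp, by simp [hx]⟩
  | cons a l ih =>
    have hB' : ∀ s ∈ l.tails, e.pos i s ∈ B := fun s hs => hB s (by simp [hs])
    obtain ⟨p, hp, hsup⟩ := ih hl.tail hB' ⟨e.pos i l, hB' l (by simp)⟩ rfl
    have hadj : (G.induce B).Adj x ⟨e.pos i l, hB' l (by simp)⟩ := by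
      simp only [SimpleGraph.comap_adj, Function.Embedding.subtype_apply, hx]
      exact (e.adj_pos_cons i a l).symm
    refine ⟨.cons hadj p, isPath_cons_of_isAcyclic hT hadj hp fun hnil => ?_, ?_⟩
    · cases l with
      | nil =>
        have := congrArg List.length hsup
        cases p with
        | nil => simp at hnil
        | cons h q => simp at this
      | cons b l =>
        cases p with
        | nil => simp at hnil
        | cons h q =>
          have hsup' : q.support.map Subtype.val = l.tails.map (e.pos i) := (List.cons.inj hsup).2
          rw [← SimpleGraph.Walk.cons_tail_support q, List.map_cons] at hsup'
          have hhead := congrArg List.head? hsup'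
          intro heq
          -- Backtracking would place a vertex at the position of its grandparent.
          refine e.pos_cons_cons_ne i (a := a) (b := b) (l := l) hl.1 ?_
          rw [← hx, heq, SimpleGraph.Walk.snd_cons]
          cases l <;> simpa using hhead
    · simp [hsup, hx]

/-- Two addresses with the same position give two paths to `i`. These coincide by acyclicity, and so
do their supports. -/
theorem pos_injOn {B : Set V} (hT : (G.induce B).IsAcyclic) {l l' : List (Fin (Δ + 1))}
    (hl : IsAddress Δ l) (hl' : IsAddress Δ l') (hB : ∀ s ∈ l.tails, e.pos i s ∈ B)
    (hB' : ∀ s ∈ l'.tails, e.pos i s ∈ B) (h : e.pos i l = e.pos i l') : l = l' := by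
  have hi : i ∈ B := hB [] (by simp)
  obtain ⟨p, hp, hs⟩ := e.exists_isPath i hT hl hB ⟨e.pos i l, hB l (by simp)⟩ ⟨i, hi⟩ rfl rfl
  obtain ⟨q, hq, hs'⟩ := e.exists_isPath i hT hl' hB' ⟨e.pos i l, hB l (by simp)⟩ ⟨i, hi⟩ h rfl
  have : p = q := congrArg Subtype.val ((hT.subsingleton_path _ _).elim ⟨p, hp⟩ ⟨q, hq⟩)
  subst this
  exact e.eq_of_map_tails_eq i (hs.symm.trans hs')

theorem pos_mem_ball {l : List (Fin (Δ + 1))} {t : ℕ} (h : l.length ≤ t) :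
    ∀ s ∈ l.tails, e.pos i s ∈ ball G i t := by
  intro s hs
  have hlen := ((List.mem_tails _ _).1 hs).length_le
  exact (e.edist_pos_le i s).trans (by exact_mod_cast hlen.trans h)

end NeighborEnum

/-- A ball of a regular graph that is a tree is a copy of the regular tree. -/
theorem exists_regularTree_embedding {V : Type*} {G : SimpleGraph V} {Δ : ℕ}
    (hreg : ∀ v, (G.neighborSet v).ncard = Δ + 1) {i : V} {t : ℕ} (hT : BallIsTree G i t) :
    ∃ φ : regularTree Δ t ↪g G, φ (treeRoot Δ t) = i ∧ Set.range φ = ball G i t := by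
  obtain ⟨e⟩ := nonempty_neighborEnum hreg
  have hT : (G.induce (ball G i t)).IsAcyclic := hT.isAcyclic
  have hinj : ∀ u v : TreeVertex Δ t, e.pos i u.1 = e.pos i v.1 → u = v := fun u v h =>
    Subtype.ext (e.pos_injOn i hT u.2.1 v.2.1 (e.pos_mem_ball i u.2.2) (e.pos_mem_ball i v.2.2) h)
  refine ⟨⟨⟨fun u => e.pos i u.1, hinj⟩, ?_⟩, rfl, ?_⟩
  · intro u v
    change G.Adj (e.pos i u.1) (e.pos i v.1) ↔ _
    constructor
    · intro h
      rcases (e.adj_pos_iff i u.2.1).1 h with ⟨a, ha, h'⟩ | ⟨b, l', hl', h'⟩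
      -- The address `a :: u.1` might have length t + 1; its position is still in the ball because
      -- it equals that of `v`.
      · refine Or.inr ⟨a, e.pos_injOn i hT v.2.1 ha (e.pos_mem_ball i v.2.2) ?_ h'⟩
        intro s hs
        rcases List.mem_cons.1 (List.tails_cons a u.1 ▸ hs) with rfl | hs
        · rw [← h']
          exact e.pos_mem_ball i v.2.2 _ (by simp)
        · exact e.pos_mem_ball i u.2.2 s hs
      · have hadd : IsAddress Δ l' := (hl' ▸ u.2.1 : IsAddress Δ (b :: l')).tail
        have hlen : l'.length ≤ t := by
          have := u.2.2
          rw [hl', List.length_cons] at this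
          omega
        refine Or.inl ⟨b, ?_⟩
        rw [hl', e.pos_injOn i hT v.2.1 hadd (e.pos_mem_ball i v.2.2) (e.pos_mem_ball i hlen) h']
    · rintro (⟨a, h⟩ | ⟨a, h⟩)
      · rw [h]
        exact (e.adj_pos_cons i a v.1).symm
      · rw [h]
        exact e.adj_pos_cons i a u.1
  · ext j
    constructor
    · rintro ⟨u, rfl⟩
      exact e.pos_mem_ball i u.2.2 _ (by simp)
    · intro hj
      have hj : G.edist i j ≤ t := hj
      obtain ⟨p, hp⟩ := SimpleGraph.exists_walk_of_edist_ne_top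
        (ne_top_of_le_ne_top (ENat.natCast_ne_top t) hj)
      obtain ⟨l, hl, hlen, hpos⟩ := e.exists_pos_eq i p.reverse
      refine ⟨⟨l, hl, ?_⟩, hpos⟩
      rw [SimpleGraph.Walk.length_reverse] at hlen
      rw [← hp] at hj
      exact hlen.trans (by exact_mod_cast hj)

/-! ### Summing out vertex variables -/

section Elimination

variable {V : Type*} [Fintype V] [DecidableEq V]

/-- Flipping the coordinate `v` is an involution, so each of the two terms sums to the full sum.
This allows resampling one coordinate without splitting the product space. -/
theorem sum_update (g : (V → Bool) → ℝ) (v : V) :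
    ∑ x, ∑ b, g (Function.update x v b) = 2 * ∑ x, g x := by
  have h1 : ∀ x : V → Bool,
      ∑ b, g (Function.update x v b) = g x + g (Function.update x v (!x v)) := by
    intro x
    rw [Fintype.sum_bool]
    cases h : x v
    · have h' : Function.update x v false = x := by rw [← h, Function.update_eq_self]
      simp [h', add_comm]
    · have h' : Function.update x v true = x := by rw [← h, Function.update_eq_self]
      simp [h']
  have h2 : ∑ x : V → Bool, g (Function.update x v (!x v)) = ∑ x, g x := by
    refine Function.Bijective.sum_comp (e := fun x : V → Bool => Function.update x v (!x v)) ?_ g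
    exact Function.Involutive.bijective fun x => by simp
  rw [Finset.sum_congr rfl fun x _ => h1 x, Finset.sum_add_distrib, h2, two_mul]

theorem sum_prod_vertexProb_mul (κ : ℝ) (Δ : ℕ) (v : V) (H : Bool → (V → Bool) → ℝ)
    (hH : ∀ b x c, H b (Function.update x v c) = H b x) :
    ∑ x, (∏ i, vertexProb κ Δ (x i)) * H (x v) x =
      ∑ x, (∏ i, vertexProb κ Δ (x i)) * ∑ b, vertexProb κ Δ b * H b x := by
  have hprod : ∀ (x : V → Bool) (b : Bool),
      ∏ i, vertexProb κ Δ (Function.update x v b i) =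
        vertexProb κ Δ b * ∏ i ∈ Finset.univ.erase v, vertexProb κ Δ (x i) := by
    intro x b
    rw [← Finset.mul_prod_erase _ _ (Finset.mem_univ v), Function.update_self]
    congr 1
    refine Finset.prod_congr rfl fun i hi => ?_
    rw [Function.update_of_ne (Finset.ne_of_mem_erase hi)]
  have key : ∀ x : V → Bool,
      ∑ c, (∏ i, vertexProb κ Δ (Function.update x v c i)) *
        H (Function.update x v c v) (Function.update x v c) =
      ∑ c, (∏ i, vertexProb κ Δ (Function.update x v c i)) *
        ∑ b, vertexProb κ Δ b * H b (Function.update x v c) := by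
    intro x
    simp only [hprod, hH, Function.update_self]
    rw [← Finset.sum_mul, ← Finset.sum_mul, sum_vertexProb, one_mul, Finset.mul_sum]
    refine Finset.sum_congr rfl fun b _ => ?_
    ring
  have h2 : (2 : ℝ) ≠ 0 := two_ne_zero
  -- After doubling, both sides become sums over `x` and a resampled value at `v`, which agree for
  -- each `x`.
  refine mul_left_cancel₀ h2 ?_
  rw [← sum_update _ v, ← sum_update _ v]
  exact Finset.sum_congr rfl fun x _ => key x

/-- Summing out the variables of a set of vertices, each of which interacts only with its
parent. -/
theorem sum_prod_vertexProb_mul_prod (κ : ℝ) (Δ : ℕ) (par : V → V) (h : V → Bool → Bool → ℝ)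
    (L : Finset V) (hpar : ∀ v ∈ L, par v ∉ L) (F : (V → Bool) → ℝ)
    (hF : ∀ v ∈ L, ∀ x b, F (Function.update x v b) = F x) :
    ∑ x, (∏ i, vertexProb κ Δ (x i)) * (F x * ∏ v ∈ L, h v (x v) (x (par v))) =
      ∑ x, (∏ i, vertexProb κ Δ (x i)) *
        (F x * ∏ v ∈ L, ∑ b, vertexProb κ Δ b * h v b (x (par v))) := by
  induction L using Finset.induction_on generalizing F with
  | empty => rfl
  | insert v L hv ih =>
    have hne : ∀ u ∈ insert v L, par u ≠ v := fun u hu heq =>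
      hpar u hu (heq ▸ Finset.mem_insert_self v L)
    have step := sum_prod_vertexProb_mul κ Δ v
      (fun b x => F x * (h v b (x (par v)) * ∏ u ∈ L, h u (x u) (x (par u)))) (by
        intro b x c
        rw [hF v (Finset.mem_insert_self v L),
          Function.update_of_ne (hne v (Finset.mem_insert_self v L))]
        congr 2
        refine Finset.prod_congr rfl fun u hu => ?_
        rw [Function.update_of_ne (hne u (Finset.mem_insert_of_mem hu)),
          Function.update_of_ne (ne_of_mem_of_not_mem hu hv)])
    -- The factor of `v` just summed out depends only on its parent, which lies outside the set, so
    -- it can be absorbed into `F`.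
    have ih' := ih (fun u hu hm => hpar u (Finset.mem_insert_of_mem hu)
        (Finset.mem_insert_of_mem hm))
      (fun x => F x * ∑ b, vertexProb κ Δ b * h v b (x (par v))) (by
        intro u hu x b
        rw [hF u (Finset.mem_insert_of_mem hu), Function.update_of_ne]
        exact fun heq => hpar v (Finset.mem_insert_self v L)
          (heq ▸ Finset.mem_insert_of_mem hu))
    simp only [Finset.prod_insert hv]
    refine step.trans (Eq.trans ?_ (ih'.trans ?_))
    · refine Finset.sum_congr rfl fun x _ => ?_
      congr 1
      rw [Finset.mul_sum, Finset.sum_mul]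
      refine Finset.sum_congr rfl fun b _ => ?_
      ring
    · refine Finset.sum_congr rfl fun x _ => ?_
      rw [mul_assoc]

end Elimination

/-! ### The regular tree -/

section Tree

variable {Δ t : ℕ}

namespace TreeVertex

/-- The parent of a vertex (the root for the root itself). -/
def parent (u : TreeVertex Δ t) : TreeVertex Δ t :=
  ⟨u.1.tail, by
    have h := u.2.1
    cases hu : u.1 with
    | nil => trivial
    | cons a l => exact IsAddress.tail (hu ▸ h), by
    have := u.2.2
    rw [List.length_tail]
    omega⟩

theorem parent_eq {u v : TreeVertex Δ t} {a : Fin (Δ + 1)} (h : u.1 = a :: v.1) :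
    u.parent = v := Subtype.ext (by simp [parent, h])

theorem ne_root_iff {u : TreeVertex Δ t} : u ≠ treeRoot Δ t ↔ 0 < u.1.length := by
  rw [List.length_pos_iff, not_iff_not]
  exact Subtype.ext_iff

theorem length_parent {u : TreeVertex Δ t} (hu : u ≠ treeRoot Δ t) :
    u.parent.1.length + 1 = u.1.length := by
  have := ne_root_iff.1 hu
  simp only [parent, List.length_tail]
  omega

theorem adj_parent {u : TreeVertex Δ t} (hu : u ≠ treeRoot Δ t) :
    (regularTree Δ t).Adj u u.parent := by
  have := ne_root_iff.1 hu
  cases h : u.1 with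
  | nil => simp [h] at this
  | cons a l => exact Or.inl ⟨a, by simp [parent, h]⟩

theorem adj_iff {u v : TreeVertex Δ t} : (regularTree Δ t).Adj u v ↔
    (u ≠ treeRoot Δ t ∧ u.parent = v) ∨ (v ≠ treeRoot Δ t ∧ v.parent = u) := by
  constructor
  · rintro (⟨a, h⟩ | ⟨a, h⟩)
    · exact Or.inl ⟨ne_root_iff.2 (by simp [h]), parent_eq h⟩
    · exact Or.inr ⟨ne_root_iff.2 (by simp [h]), parent_eq h⟩
  · rintro (⟨h, rfl⟩ | ⟨h, rfl⟩)
    · exact adj_parent h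
    · exact (adj_parent h).symm

end TreeVertex

open TreeVertex

open Classical in
/-- The label of the edge from a vertex to its parent. -/
def edgeLabel (w : (regularTree Δ t).edgeSet → ℤˣ) (u : TreeVertex Δ t) : ℤˣ :=
  -- The default value occurs only at the root, whose label enters no product.
  if h : (regularTree Δ t).Adj u u.parent then w ⟨s(u, u.parent), h⟩ else 1

/-- The conditional probability of an edge label given the variables of its endpoints. -/
def edgeKernel (s : ℤˣ) (b c : Bool) : ℝ := if b = true ∧ c = true then Q₁ s else Q₀ s

theorem edgeWeight_mk {V : Type*} (x : V → Bool) (u v : V) (s : ℤˣ) :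
    edgeWeight x s(u, v) s = edgeKernel s (x u) (x v) := by
  simp only [edgeWeight, edgeKernel]
  congr 1
  simp

-- Each edge joins a unique non-root vertex to its parent, so the edges are indexed by non-root
-- vertices.
open Classical in
theorem edgeProb_regularTree (x : TreeVertex Δ t → Bool)
    (w : (regularTree Δ t).edgeSet → ℤˣ) :
    edgeProb (regularTree Δ t) x w =
      ∏ u with u ≠ treeRoot Δ t, edgeKernel (edgeLabel w u) (x u) (x u.parent) := by
  rw [edgeProb_eq]
  symm
  refine Finset.prod_bij (fun u hu => ⟨s(u, u.parent), adj_parent (Finset.mem_filter.1 hu).2⟩)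
    (fun _ _ => Finset.mem_univ _) ?_ ?_ ?_
  · intro u hu v hv h
    rcases Sym2.eq_iff.1 (Subtype.ext_iff.1 h) with h | h
    · exact h.1
    · have h1 := length_parent (Finset.mem_filter.1 hu).2
      have h2 := length_parent (Finset.mem_filter.1 hv).2
      rw [h.2] at h1
      rw [← h.1] at h2
      omega
  · rintro ⟨e, he⟩ -
    induction e with | _ u v =>
    rcases adj_iff.1 (show (regularTree Δ t).Adj u v from he) with ⟨h, rfl⟩ | ⟨h, rfl⟩
    · exact ⟨u, by simp [h], rfl⟩
    · exact ⟨v, by simp [h], Subtype.ext Sym2.eq_swap⟩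
  · intro u hu
    rw [edgeWeight_mk, edgeLabel, dif_pos (adj_parent (Finset.mem_filter.1 hu).2)]

open Classical in
/-- The children of a vertex. -/
def children (v : TreeVertex Δ t) : Finset (TreeVertex Δ t) :=
  {u | u ≠ treeRoot Δ t ∧ u.parent = v}

theorem mem_children {u v : TreeVertex Δ t} :
    u ∈ children v ↔ u ≠ treeRoot Δ t ∧ u.parent = v := by
  simp [children]

/-- The likelihood of the labels of the edges of the `k` generations below `v`, given the variable
of `v`. -/
def likelihood (κ : ℝ) (w : (regularTree Δ t).edgeSet → ℤˣ) : ℕ → TreeVertex Δ t → Bool → ℝ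
  | 0, _, _ => 1
  | k + 1, v, c => ∏ u ∈ children v,
      ∑ b, vertexProb κ Δ b * (edgeKernel (edgeLabel w u) b c * likelihood κ w k u b)

-- Induction from the leaves upward: after `k` rounds the generations below `s = t - k` enter only
-- through the likelihoods of generation `s`.
open Classical in
theorem sum_eq_sum_likelihood (κ : ℝ) (w : (regularTree Δ t).edgeSet → ℤˣ) (b : Bool)
    (k s : ℕ) (hs : s + k = t) :
    ∑ x : TreeVertex Δ t → Bool, (∏ i, vertexProb κ Δ (x i)) *
        ((if x (treeRoot Δ t) = b then 1 else 0) *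
          ∏ u with u ≠ treeRoot Δ t, edgeKernel (edgeLabel w u) (x u) (x u.parent)) =
      ∑ x : TreeVertex Δ t → Bool, (∏ i, vertexProb κ Δ (x i)) *
        (((if x (treeRoot Δ t) = b then 1 else 0) *
          ∏ u with u ≠ treeRoot Δ t ∧ u.1.length ≤ s,
            edgeKernel (edgeLabel w u) (x u) (x u.parent)) *
          ∏ v with v.1.length = s, likelihood κ w k v (x v)) := by
  induction k generalizing s with
  | zero =>
    obtain rfl : s = t := by omega
    refine Finset.sum_congr rfl fun x _ => ?_
    simp only [likelihood, Finset.prod_const_one, mul_one]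
    congr 2
    refine Finset.prod_congr ?_ fun _ _ => rfl
    ext u
    simp [u.2.2]
  | succ k ih =>
    rw [ih (s + 1) (by omega)]
    have h1 := sum_prod_vertexProb_mul_prod κ Δ (parent (Δ := Δ) (t := t))
      (fun u b c => edgeKernel (edgeLabel w u) b c * likelihood κ w k u b)
      {u | u.1.length = s + 1} (by
        intro u hu hu'
        simp only [Finset.mem_filter, Finset.mem_univ, true_and] at hu hu'
        have := length_parent (ne_root_iff.2 (by omega : 0 < u.1.length))
        omega)
      (fun x => (if x (treeRoot Δ t) = b then 1 else 0) *
          ∏ u with u ≠ treeRoot Δ t ∧ u.1.length ≤ s,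
            edgeKernel (edgeLabel w u) (x u) (x u.parent)) (by
        intro v hv x c
        simp only [Finset.mem_filter, Finset.mem_univ, true_and] at hv
        rw [Function.update_of_ne (ne_root_iff.2 (by omega : 0 < v.1.length)).symm]
        congr 1
        refine Finset.prod_congr rfl fun u hu => ?_
        simp only [Finset.mem_filter, Finset.mem_univ, true_and] at hu
        have := length_parent hu.1
        rw [Function.update_of_ne, Function.update_of_ne]
        · rintro rfl
          omega
        · rintro rfl
          omega)
    refine Eq.trans (Finset.sum_congr rfl fun x _ => ?_) (h1.trans
      (Finset.sum_congr rfl fun x _ => ?_))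
    · congr 1
      rw [Finset.prod_mul_distrib, ← mul_assoc]
      congr 1
      rw [mul_assoc]
      congr 1
      rw [← Finset.prod_union]
      · refine Finset.prod_congr ?_ fun _ _ => rfl
        ext u
        simp only [Finset.mem_union, Finset.mem_filter, Finset.mem_univ, true_and, ne_root_iff]
        omega
      · rw [Finset.disjoint_filter]
        intro u _ hu
        omega
    · congr 2
      -- Grouping generation `s + 1` by parent produces the recursion of `likelihood`.
      rw [← Finset.prod_fiberwise_of_maps_to (g := parent) (t := {v | v.1.length = s})]
      · refine Finset.prod_congr rfl fun v hv => ?_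
        simp only [Finset.mem_filter, Finset.mem_univ, true_and] at hv
        rw [likelihood]
        refine Finset.prod_congr ?_ ?_
        · ext u
          simp only [Finset.mem_filter, Finset.mem_univ, true_and, mem_children, ne_root_iff]
          constructor
          · rintro ⟨h, h'⟩
            exact ⟨by omega, h'⟩
          · rintro ⟨h, h'⟩
            refine ⟨?_, h'⟩
            rw [← length_parent (ne_root_iff.2 h), h', hv]
        · intro u hu
          rw [(mem_children.1 hu).2]
      · intro u hu
        simp only [Finset.mem_filter, Finset.mem_univ, true_and] at hu ⊢
        have := length_parent (ne_root_iff.2 (by omega : 0 < u.1.length))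
        omega

theorem marginal_regularTree (κ : ℝ) (w : (regularTree Δ t).edgeSet → ℤˣ) (b : Bool) :
    marginal (regularTree Δ t) κ Δ (treeRoot Δ t) b w =
      vertexProb κ Δ b * likelihood κ w t (treeRoot Δ t) b := by
  classical
  have h1 : marginal (regularTree Δ t) κ Δ (treeRoot Δ t) b w =
      ∑ x : TreeVertex Δ t → Bool, (∏ i, vertexProb κ Δ (x i)) *
        ((if x (treeRoot Δ t) = b then 1 else 0) *
          ∏ u with u ≠ treeRoot Δ t, edgeKernel (edgeLabel w u) (x u) (x u.parent)) := by
    unfold marginal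
    refine Finset.sum_congr (by ext; simp) fun x _ => ?_
    rw [weight, edgeProb_regularTree]
    split_ifs <;> simp
  rw [h1, sum_eq_sum_likelihood κ w b t 0 (by omega)]
  have h2 : ∀ x : TreeVertex Δ t → Bool,
      ((if x (treeRoot Δ t) = b then 1 else 0) *
          ∏ u with u ≠ treeRoot Δ t ∧ u.1.length ≤ 0,
            edgeKernel (edgeLabel w u) (x u) (x u.parent)) *
          ∏ v with v.1.length = 0, likelihood κ w t v (x v) =
        if x (treeRoot Δ t) = b then likelihood κ w t (treeRoot Δ t) b else 0 := by
    intro x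
    rw [Finset.filter_eq_empty_iff.2 (fun u _ hu => by have := ne_root_iff.1 hu.1; omega),
      Finset.prod_empty, mul_one]
    have : (Finset.univ.filter fun v : TreeVertex Δ t => v.1.length = 0) = {treeRoot Δ t} := by
      ext u
      have := ne_root_iff (u := u)
      simp only [Finset.mem_filter, Finset.mem_univ, true_and, Finset.mem_singleton]
      rw [← not_iff_not]
      exact (this.trans Nat.pos_iff_ne_zero).symm
    rw [this, Finset.prod_singleton]
    split_ifs with h <;> simp [h]
  rw [Finset.sum_congr rfl fun x _ => by rw [h2 x]]
  have h3 := sum_prod_vertexProb_mul κ Δ (treeRoot Δ t)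
    (fun c _ => if c = b then likelihood κ w t (treeRoot Δ t) b else 0) (fun _ _ _ => rfl)
  refine h3.trans ?_
  rw [← Finset.sum_mul, ← Fintype.prod_sum fun (_ : TreeVertex Δ t) b => vertexProb κ Δ b,
    Finset.prod_eq_one fun _ _ => sum_vertexProb κ Δ]
  simp

theorem edgeKernel_false (s : ℤˣ) (b : Bool) : edgeKernel s b false = 1 / 2 := by
  simp [edgeKernel, Q₀]

theorem edgeKernel_false_left (s : ℤˣ) (c : Bool) : edgeKernel s false c = 1 / 2 := by
  simp [edgeKernel, Q₀]

theorem edgeKernel_true_true (s : ℤˣ) : edgeKernel s true true = (1 + ((s : ℤ) : ℝ)) / 2 := by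
  rcases Int.units_eq_one_or s with rfl | rfl <;> norm_num [edgeKernel, Q₁]

theorem edgeKernel_nonneg (s : ℤˣ) (b c : Bool) : 0 ≤ edgeKernel s b c := by
  unfold edgeKernel
  split_ifs
  exacts [Q₁_nonneg s, Q₀_nonneg s]

variable {κ : ℝ}

theorem likelihood_nonneg (hκ : 0 < κ) (hΔ : 1 ≤ Δ) (w : (regularTree Δ t).edgeSet → ℤˣ)
    (k : ℕ) (v : TreeVertex Δ t) (c : Bool) : 0 ≤ likelihood κ w k v c := by
  induction k generalizing v c with
  | zero => exact zero_le_one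
  | succ k ih =>
    exact Finset.prod_nonneg fun u _ => Finset.sum_nonneg fun b _ =>
      mul_nonneg (vertexProb_pos hκ hΔ b).le (mul_nonneg (edgeKernel_nonneg _ _ _) (ih u b))

theorem likelihood_false_pos (hκ : 0 < κ) (hΔ : 1 ≤ Δ) (w : (regularTree Δ t).edgeSet → ℤˣ)
    (k : ℕ) (v : TreeVertex Δ t) : 0 < likelihood κ w k v false := by
  induction k generalizing v with
  | zero => exact zero_lt_one
  | succ k ih =>
    refine Finset.prod_pos fun u _ => ?_
    have h0 := vertexProb_pos hκ hΔ false
    have h1 := vertexProb_pos hκ hΔ true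
    have h2 := ih u
    have h3 := likelihood_nonneg hκ hΔ w k u true
    rw [Fintype.sum_bool, edgeKernel_false, edgeKernel_false]
    positivity

/-- Dividing both sums by half of `vertexProb κ Δ false * A false` turns the prior odds κ/√Δ times
`A true / A false` into message/√Δ. -/
theorem bpFactor_eq (hκ : 0 < κ) (hΔ : 1 ≤ Δ) (s : ℤˣ) {A : Bool → ℝ} (h0 : 0 < A false)
    (h1 : 0 ≤ A true) :
    bpFactor Δ s (κ * (A true / A false)) =
      (∑ b, vertexProb κ Δ b * (edgeKernel s b true * A b)) /
        ∑ b, vertexProb κ Δ b * (edgeKernel s b false * A b) := by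
  have hsq : 0 < √(Δ : ℝ) := Real.sqrt_pos.2 (by exact_mod_cast hΔ)
  have hp := vertexProb_pos hκ hΔ false
  simp only [Fintype.sum_bool, edgeKernel_false, edgeKernel_false_left, edgeKernel_true_true,
    vertexProb_true hκ hΔ, bpFactor]
  have hd : 0 < √(Δ : ℝ) * A false + κ * A true := by positivity
  field_simp
  ring

theorem likelihood_ratio_succ (hκ : 0 < κ) (hΔ : 1 ≤ Δ) (w : (regularTree Δ t).edgeSet → ℤˣ)
    (k : ℕ) (v : TreeVertex Δ t) :
    likelihood κ w (k + 1) v true / likelihood κ w (k + 1) v false =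
      ∏ u ∈ children v, bpFactor Δ (edgeLabel w u)
        (κ * (likelihood κ w k u true / likelihood κ w k u false)) := by
  rw [likelihood, likelihood, ← Finset.prod_div_distrib]
  refine Finset.prod_congr rfl fun u _ => ?_
  rw [bpFactor_eq hκ hΔ _ (likelihood_false_pos hκ hΔ w k u) (likelihood_nonneg hκ hΔ w k u true)]

/-! ### Exactness of belief propagation on tree-like balls. -/

section BeliefPropagation

variable {V : Type*} {G : SimpleGraph V} (φ : regularTree Δ t ↪g G)

theorem edist_embedding_le (u : TreeVertex Δ t) :
    G.edist (φ (treeRoot Δ t)) (φ u) ≤ u.1.length := by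
  induction hn : u.1.length generalizing u with
  | zero =>
    have : u = treeRoot Δ t := by
      by_contra h
      have := ne_root_iff.1 h
      omega
    simp [this]
  | succ m ih =>
    have hu : u ≠ treeRoot Δ t := ne_root_iff.2 (by omega)
    have hlen := length_parent hu
    refine (G.edist_triangle (v := φ u.parent)).trans ?_
    rw [SimpleGraph.edist_eq_one_iff_adj.2 (φ.map_adj_iff.2 (adj_parent hu).symm), Nat.cast_add,
      Nat.cast_one]
    gcongr
    exact ih _ (by omega)

/-- A vertex above the leaves has all its neighbors in the ball, so the updates there see only the
tree. -/
theorem exists_of_adj_embedding (hφ : Set.range φ = ball G (φ (treeRoot Δ t)) t)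
    {u : TreeVertex Δ t} (hu : u.1.length < t) {l : V} (hl : G.Adj (φ u) l) :
    ∃ v, (regularTree Δ t).Adj u v ∧ φ v = l := by
  have : l ∈ Set.range φ := by
    rw [hφ]
    refine (G.edist_triangle (v := φ u)).trans ?_
    rw [SimpleGraph.edist_eq_one_iff_adj.2 hl]
    calc G.edist (φ (treeRoot Δ t)) (φ u) + 1 ≤ (u.1.length : ℕ∞) + 1 := by
          gcongr
          exact edist_embedding_le φ u
      _ ≤ t := by exact_mod_cast hu
  obtain ⟨v, rfl⟩ := this
  exact ⟨v, φ.map_adj_iff.1 hl, rfl⟩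

theorem edgeLabel_comp (w : G.edgeSet → ℤˣ) {u c : TreeVertex Δ t} (hc : c ∈ children u)
    (h : G.Adj (φ u) (φ c)) :
    edgeLabel (w ∘ φ.mapEdgeSet) c = w ⟨s(φ u, φ c), h⟩ := by
  obtain ⟨hc', rfl⟩ := mem_children.1 hc
  rw [edgeLabel, dif_pos (adj_parent hc')]
  exact congrArg w (Subtype.ext Sym2.eq_swap)

theorem adj_of_mem_children {u c : TreeVertex Δ t} (hc : c ∈ children u) :
    G.Adj (φ u) (φ c) := by
  obtain ⟨hc', rfl⟩ := mem_children.1 hc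
  exact φ.map_adj_iff.2 (adj_parent hc').symm

/-- The neighbors other than the parent are the children, so the update is `likelihood_ratio_succ`.
The depth bound keeps all `k` generations below `u` inside the ball. -/
theorem bpMessage_eq [Fintype V] (hκ : 0 < κ) (hΔ : 1 ≤ Δ)
    (hφ : Set.range φ = ball G (φ (treeRoot Δ t)) t) (w : G.edgeSet → ℤˣ) (k : ℕ)
    (u : TreeVertex Δ t) (hu : u ≠ treeRoot Δ t) (hk : u.1.length + k ≤ t) :
    bpMessage G κ Δ w k (φ u) (φ u.parent) =
      κ * (likelihood κ (w ∘ φ.mapEdgeSet) k u true /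
        likelihood κ (w ∘ φ.mapEdgeSet) k u false) := by
  classical
  induction k generalizing u with
  | zero => simp [bpMessage, likelihood]
  | succ k ih =>
    rw [likelihood_ratio_succ hκ hΔ, bpMessage]
    congr 1
    symm
    refine Finset.prod_bij (fun c hc => ⟨φ c, adj_of_mem_children φ hc, ?_⟩)
      (fun _ _ => Finset.mem_univ _) ?_ ?_ ?_
    · intro heq
      obtain ⟨hc', rfl⟩ := mem_children.1 hc
      have h1 := length_parent hu
      have h2 := length_parent hc'
      have h3 : c.1.length = c.parent.parent.1.length :=
        congrArg (fun z : TreeVertex Δ t => z.1.length) (φ.injective heq)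
      omega
    · intro c _ c' _ h
      exact φ.injective (Subtype.ext_iff.1 h)
    · rintro ⟨l, hl, hne⟩ -
      obtain ⟨c, hc, rfl⟩ := exists_of_adj_embedding φ hφ (by omega) hl
      rcases adj_iff.1 hc with ⟨-, rfl⟩ | h
      · exact absurd rfl hne
      · exact ⟨c, mem_children.2 h, rfl⟩
    · intro c hc
      rw [edgeLabel_comp φ w hc (adj_of_mem_children φ hc)]
      obtain ⟨hc', rfl⟩ := mem_children.1 hc
      have := length_parent hc'
      rw [ih c hc' (by omega)]

theorem bpVertex_eq [Fintype V] (hκ : 0 < κ) (hΔ : 1 ≤ Δ)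
    (hφ : Set.range φ = ball G (φ (treeRoot Δ t)) t) (w : G.edgeSet → ℤˣ) :
    bpVertex G κ Δ w t (φ (treeRoot Δ t)) =
      κ * (likelihood κ (w ∘ φ.mapEdgeSet) t (treeRoot Δ t) true /
        likelihood κ (w ∘ φ.mapEdgeSet) t (treeRoot Δ t) false) := by
  classical
  cases t with
  | zero => simp [bpVertex, likelihood]
  | succ k =>
    rw [likelihood_ratio_succ hκ hΔ, bpVertex]
    congr 1
    symm
    refine Finset.prod_bij (fun c hc => ⟨φ c, adj_of_mem_children φ hc⟩)
      (fun _ _ => Finset.mem_univ _) ?_ ?_ ?_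
    · intro c _ c' _ h
      exact φ.injective (Subtype.ext_iff.1 h)
    · rintro ⟨l, hl⟩ -
      obtain ⟨c, hc, rfl⟩ := exists_of_adj_embedding φ hφ (by simp [treeRoot]) hl
      rcases adj_iff.1 hc with ⟨h, -⟩ | h
      · exact absurd rfl h
      · exact ⟨c, mem_children.2 h, rfl⟩
    · intro c hc
      rw [edgeLabel_comp φ w hc (adj_of_mem_children φ hc)]
      obtain ⟨hc', hpar⟩ := mem_children.1 hc
      have hlen := length_parent hc'
      rw [hpar] at hlen
      simp only [treeRoot, List.length_nil] at hlen
      -- Children of the root have depth 1 and `k` iterations remain, which exactly exhausts `t = k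
      -- + 1`.
      have hm := bpMessage_eq φ hκ hΔ hφ w k c hc' (by omega)
      rw [hpar] at hm
      exact congrArg (bpFactor Δ _) hm.symm

/-- Since the prior odds are κ/√Δ, the threshold √Δ compares the two joint probabilities: belief
propagation is the maximum a posteriori rule. -/
theorem mem_bpEstimator_iff [Fintype V] (hκ : 0 < κ) (hΔ : 1 ≤ Δ)
    (hφ : Set.range φ = ball G (φ (treeRoot Δ t)) t) (w : G.edgeSet → ℤˣ)
    (u : G.edgeSet → unitInterval) :
    φ (treeRoot Δ t) ∈ bpEstimator G κ Δ t w u ↔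
      marginal (regularTree Δ t) κ Δ (treeRoot Δ t) false (w ∘ φ.mapEdgeSet) ≤
        marginal (regularTree Δ t) κ Δ (treeRoot Δ t) true (w ∘ φ.mapEdgeSet) := by
  have hsq : 0 < √(Δ : ℝ) := Real.sqrt_pos.2 (by exact_mod_cast hΔ)
  have hp := vertexProb_pos hκ hΔ false
  have hA := likelihood_false_pos hκ hΔ (w ∘ φ.mapEdgeSet) t (treeRoot Δ t)
  change √(Δ : ℝ) ≤ bpVertex G κ Δ w t (φ (treeRoot Δ t)) ↔ _
  rw [bpVertex_eq φ hκ hΔ hφ, marginal_regularTree, marginal_regularTree, vertexProb_true hκ hΔ,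
    mul_right_comm, mul_comm (vertexProb κ Δ false), mul_le_mul_iff_left₀ hp, div_mul_eq_mul_div,
    le_div_iff₀ hsq, ← mul_div_assoc, le_div_iff₀ hA, mul_comm]

end BeliefPropagation

end Tree

/-! ### Errors at tree-like vertices and the limit -/

section TreeLike

variable {V : Type*} [Fintype V] {G : SimpleGraph V} {κ : ℝ} {Δ t : ℕ}

theorem vertexError_bpEstimator (hκ : 0 < κ) (hΔ : 1 ≤ Δ)
    (hreg : ∀ v, (G.neighborSet v).ncard = Δ + 1) {i : V} (hT : BallIsTree G i t) :
    vertexError G κ Δ (bpEstimator G κ Δ t) i = treeError κ Δ t := by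
  classical
  obtain ⟨φ, rfl, hφ⟩ := exists_regularTree_embedding hreg hT
  have h : ∀ u, condVertexError G κ Δ (bpEstimator G κ Δ t) (φ (treeRoot Δ t)) u =
      treeError κ Δ t := fun u => by
    rw [treeError_eq_bayesError hκ hΔ]
    exact condVertexError_eq_bayesError φ _ _ u fun w => mem_bpEstimator_iff φ hκ hΔ hφ w u
  simp [vertexError, h]

theorem treeError_le_vertexError (hκ : 0 < κ) (hΔ : 1 ≤ Δ)
    (hreg : ∀ v, (G.neighborSet v).ncard = Δ + 1) {C : Estimator G} (hC : IsLocal G t C) {i : V}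
    (hT : BallIsTree G i t) :
    treeError κ Δ t ≤ vertexError G κ Δ C i := by
  classical
  obtain ⟨φ, rfl, hφ⟩ := exists_regularTree_embedding hreg hT
  have h : ∀ u, treeError κ Δ t ≤ condVertexError G κ Δ C (φ (treeRoot Δ t)) u := fun u => by
    rw [treeError_eq_bayesError hκ hΔ]
    refine bayesError_le_condVertexError φ C _ u fun w w' hw => ?_
    -- An edge with both ends in the ball is the image of a tree edge, where `w` and `w'` agree.
    refine hC.local_mem _ w w' u u fun e he => ⟨?_, rfl⟩
    obtain ⟨e, hmem⟩ := e
    induction e with | _ a b =>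
    obtain ⟨a, rfl⟩ : a ∈ Set.range φ := hφ ▸ he a (Sym2.mem_mk_left _ _)
    obtain ⟨b, rfl⟩ : b ∈ Set.range φ := hφ ▸ he _ (Sym2.mem_mk_right _ _)
    have hab : (regularTree Δ t).Adj a b := φ.map_adj_iff.1 hmem
    exact congrFun hw ⟨s(a, b), hab⟩
  refine le_trans ?_ (integral_mono (integrable_const (treeError κ Δ t))
    (integrable_condVertexError hκ hΔ hC.measurableSet _ _) h)
  simp

theorem ncard_mul_treeError_le (hκ : 0 < κ) (hΔ : 1 ≤ Δ)
    (hreg : ∀ v, (G.neighborSet v).ncard = Δ + 1) {C : Estimator G} (hC : IsLocal G t C) :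
    {i | BallIsTree G i t}.ncard * treeError κ Δ t ≤ expectedError G κ Δ C := by
  classical
  rw [expectedError_eq_sum_vertexError hκ hΔ hC.measurableSet, Set.ncard_eq_toFinset_card',
    ← nsmul_eq_mul]
  refine (Finset.card_nsmul_le_sum _ _ _ fun i hi => ?_).trans
    (Finset.sum_le_sum_of_subset_of_nonneg (Finset.subset_univ _)
      fun i _ _ => vertexError_nonneg hκ hΔ G C i)
  exact treeError_le_vertexError hκ hΔ hreg hC (by simpa using hi)

theorem expectedError_le_card (hκ : 0 < κ) (hΔ : 1 ≤ Δ) {C : Estimator G}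
    (hC : ∀ (i : V) (w : G.edgeSet → ℤˣ), MeasurableSet {u | i ∈ C w u}) :
    expectedError G κ Δ C ≤ Fintype.card V := by
  rw [expectedError_eq_sum_vertexError hκ hΔ hC]
  exact (Finset.sum_le_card_nsmul _ _ 1 fun i _ => vertexError_le_one hκ hΔ hC i).trans (by simp)

theorem measurableSet_bpEstimator (G : SimpleGraph V) (κ : ℝ) (Δ t : ℕ) (i : V)
    (w : G.edgeSet → ℤˣ) : MeasurableSet {u | i ∈ bpEstimator G κ Δ t w u} :=
  MeasurableSet.const _

theorem expectedError_bpEstimator_bounds (hκ : 0 < κ) (hΔ : 1 ≤ Δ)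
    (hreg : ∀ v, (G.neighborSet v).ncard = Δ + 1) :
    {i | BallIsTree G i t}.ncard * treeError κ Δ t ≤
        expectedError G κ Δ (bpEstimator G κ Δ t) ∧
      expectedError G κ Δ (bpEstimator G κ Δ t) ≤
        {i | BallIsTree G i t}.ncard * treeError κ Δ t +
          (Fintype.card V - {i | BallIsTree G i t}.ncard) := by
  classical
  have hmeas := measurableSet_bpEstimator G κ Δ t
  have hsum : ∑ i ∈ {i | BallIsTree G i t}.toFinset,
      vertexError G κ Δ (bpEstimator G κ Δ t) i =
        {i | BallIsTree G i t}.ncard * treeError κ Δ t := by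
    rw [Set.ncard_eq_toFinset_card', ← nsmul_eq_mul]
    exact Finset.sum_eq_card_nsmul fun i hi =>
      vertexError_bpEstimator hκ hΔ hreg (by simpa using hi)
  rw [expectedError_eq_sum_vertexError hκ hΔ hmeas,
    ← Finset.sum_add_sum_compl {i | BallIsTree G i t}.toFinset, hsum]
  refine ⟨le_add_of_nonneg_right (Finset.sum_nonneg fun i _ => vertexError_nonneg hκ hΔ G _ i), ?_⟩
  refine add_le_add_right ((Finset.sum_le_card_nsmul _ _ 1
    fun i _ => vertexError_le_one hκ hΔ hmeas i).trans ?_) _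
  rw [Finset.card_compl, nsmul_one, Nat.cast_sub (Finset.card_le_univ _),
    Set.ncard_eq_toFinset_card']

end TreeLike

end HiddenSet

end

/-! ### Passage to the limit. -/

theorem mainTheorem7 (κ : ℝ) (hκ : 0 < κ) (Δ : ℕ) (hΔ : 1 ≤ Δ)
    (n : ℕ → ℕ) (hn : Tendsto n atTop atTop)
    (G : ∀ k, SimpleGraph (Fin (n k)))
    (hreg : ∀ k i, ((G k).neighborSet i).ncard = Δ + 1)
    (htree : HiddenSet.LocallyTreeLike G) (t : ℕ) :
    Tendsto
        (fun k => HiddenSet.expectedError (G k) κ Δ (HiddenSet.bpEstimator (G k) κ Δ t) / (n k : ℝ))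
        atTop (𝓝 (HiddenSet.treeError κ Δ t)) ∧
      ∀ C : ∀ k, HiddenSet.Estimator (G k), (∀ k, HiddenSet.IsLocal (G k) t (C k)) →
        HiddenSet.treeError κ Δ t ≤
          liminf (fun k => HiddenSet.expectedError (G k) κ Δ (C k) / (n k : ℝ)) atTop := by
  have hfrac := htree t
  have hlow := hfrac.mul_const (HiddenSet.treeError κ Δ t)
  rw [one_mul] at hlow
  constructor
  -- The upper bound adds the fraction of vertices whose ball is not a tree.
  · have hupp := hlow.add (hfrac.const_sub 1)
    rw [sub_self, add_zero] at hupp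
    refine tendsto_of_tendsto_of_tendsto_of_le_of_le' hlow hupp ?_ ?_
    · filter_upwards with k
      rw [div_mul_eq_mul_div]
      exact div_le_div_of_nonneg_right
        (HiddenSet.expectedError_bpEstimator_bounds hκ hΔ (hreg k)).1 (Nat.cast_nonneg _)
    · filter_upwards [hn.eventually_ge_atTop 1] with k hk
      have hpos : (0 : ℝ) < n k := by exact_mod_cast hk
      have h := (HiddenSet.expectedError_bpEstimator_bounds (t := t) hκ hΔ (hreg k)).2
      rw [Fintype.card_fin] at h
      rw [div_le_iff₀ hpos]
      refine h.trans_eq ?_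
      field_simp
  · intro C hC
    rw [← hlow.liminf_eq]
    refine liminf_le_liminf (Eventually.of_forall fun k => ?_) hlow.isBoundedUnder_ge ?_
    · rw [div_mul_eq_mul_div]
      exact div_le_div_of_nonneg_right
        (HiddenSet.ncard_mul_treeError_le hκ hΔ (hreg k) (hC k)) (Nat.cast_nonneg _)
    -- A real `liminf` is meaningful only with an upper bound; the normalized error is at most 1.
    · refine IsBoundedUnder.isCoboundedUnder_ge ⟨1, ?_⟩
      rw [eventually_map]
      filter_upwards with k
      refine div_le_one_of_le₀ ?_ (Nat.cast_nonneg _)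
      refine (HiddenSet.expectedError_le_card hκ hΔ (hC k).measurableSet).trans ?_
      rw [Fintype.card_fin]
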